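/- Let $\mathcal H_1,\mathcal H_2$ be complex Hilbert spaces and $\mathcal H=\mathcal H_1\otimes\mathcal H_2$ their Hilbert space tensor product. Let $\hat A$ be a closed densely defined operator on $\mathcal H_1$ and $\hat B$ a closed densely defined operator on $\mathcal H_2$ with $[\hat B,\hat B^\dagger]=c$ for a real number $c>0$, i.e. $\hat B\hat B^\dagger=\hat B^\dagger\hat B+c$ as an equality of unbounded operators (equal domains included). On $\mathcal H$ write $\hat A+\hat B^\dagger$ and $\hat A^\dagger+\hat B$ for the closures of $\hat A\otimes 1+1\otimes\hat B^\dagger$ and $\hat A^\dagger\otimes 1+1\otimes\hat B$ (defined on the spans of the product vectors of the respective domains). Let $\hat\varrho$ be a bipartite separable state on $\mathcal H$, i.e. a density operator of the form $\hat\varrho=\sum_i p_i\,\hat\varrho_{1,i}\otimes\hat\varrho_{2,i}$, a finite or countable sum with $p_i\geqslant 0$, $\sum_i p_i=1$, and density operators $\hat\varrho_{1,i}$ on $\mathcal H_1$ and $\hat\varrho_{2,i}$ on $\mathcal H_2$. Then, for every integer $n\geqslant 0$ for which the expectation value $$f_n(\hat A,\hat B)=\bigl\langle(\hat A^\dagger+\hat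 B)^n(\hat A+\hat B^\dagger)^n\bigr\rangle=\operatorname{Tr}\bigl(\hat\varrho^{1/2}(\hat A^\dagger+\hat B)^n\cdot(\hat A+\hat B^\dagger)^n\hat\varrho^{1/2}\bigr)$$ exists, it is real and $$f_n(\hat A,\hat B)\geqslant c^n\,n!.$$ Here the expectation value exists if $(\hat A+\hat B^\dagger)^n\hat\varrho^{1/2}$ is everywhere defined and bounded, $(\hat A^\dagger+\hat B)^n$ is densely defined, $\hat\varrho^{1/2}(\hat A^\dagger+\hat B)^n$ extends to a bounded operator, and the product of these two bounded operators is of trace class. -/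

import Mathlib

open scoped TensorProduct LinearPMap Nat

noncomputable section

namespace Separability

/-! ### Unbounded operators: products and powers on their natural domains, commutators -/

section Operators

variable {E : Type*} [NormedAddCommGroup E] [InnerProductSpace ℂ E]

/-- The product `S T` of two partially defined operators, on its natural domain
`{u ∈ dom T | T u ∈ dom S}`. -/
def opMul (S T : E →ₗ.[ℂ] E) : E →ₗ.[ℂ] E :=
  S.comp (T.domRestrict ((S.domain.comap T.toFun).map T.domain.subtype)) (by
    rintro ⟨u, hu⟩
    obtain ⟨⟨w, hw, hwu⟩, hu'⟩ := hu
    have h : (w : E) = u := hwu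
    subst h
    exact hw)

theorem mem_opMul_domain (S T : E →ₗ.[ℂ] E) (u : E) :
    u ∈ (opMul S T).domain ↔ ∃ h : u ∈ T.domain, T ⟨u, h⟩ ∈ S.domain := by
  constructor
  · rintro ⟨⟨w, hw, hwu⟩, hu'⟩
    have h : (w : E) = u := hwu
    subst h
    exact ⟨w.2, hw⟩
  · rintro ⟨h, h'⟩
    exact ⟨⟨⟨u, h⟩, h', rfl⟩, h⟩

theorem opMul_apply (S T : E →ₗ.[ℂ] E) (u : E) (h : u ∈ T.domain)
    (h' : T ⟨u, h⟩ ∈ S.domain) (hu : u ∈ (opMul S T).domain) :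
    opMul S T ⟨u, hu⟩ = S ⟨T ⟨u, h⟩, h'⟩ := rfl

/-- The powers of a partially defined operator, on their natural domains; `T ^ 0` is the identity
with full domain. -/
def opPow (T : E →ₗ.[ℂ] E) : ℕ → (E →ₗ.[ℂ] E)
  | 0 => (LinearMap.id : E →ₗ[ℂ] E).toPMap ⊤
  | n + 1 => opMul T (opPow T n)

/-- `[S, T] = c` for a scalar `c`, as an equality `S T = T S + c` of unbounded operators: `S T` and
`T S` have the same domain, and `S T u - T S u = c u` for every `u` in it. -/
def HasCommutator (S T : E →ₗ.[ℂ] E) (c : ℂ) : Prop :=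
  (opMul S T).domain = (opMul T S).domain ∧
    ∀ (u : E) (h : u ∈ (opMul S T).domain) (h' : u ∈ (opMul T S).domain),
      opMul S T ⟨u, h⟩ - opMul T S ⟨u, h'⟩ = c • u

end Operators

/-! ### Trace, density operators, expectation values -/

section States

variable {E : Type*} [NormedAddCommGroup E] [InnerProductSpace ℂ E]

/-- The bounded operator `T` is of trace class and its trace is `t`: in every Hilbert basis the
diagonal matrix elements are (unconditionally) summable, with sum `t`. -/
def HasTrace (T : E →L[ℂ] E) (t : ℂ) : Prop :=
  ∀ (s : Set E) (e : HilbertBasis s ℂ E), HasSum (fun i => inner ℂ (e i) (T (e i))) t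

variable [CompleteSpace E]

/-- Density operators (quantum states): positive operators of trace one. -/
def IsDensityOperator (ρ : E →L[ℂ] E) : Prop :=
  ρ.IsPositive ∧ HasTrace ρ 1

/-- `⟨Y X⟩ = v` in the state `ρ`, for unbounded operators `Y` and `X`: the expectation value
`Tr (ρ Y X)`, understood as `Tr ((√ρ Y) (X √ρ))`, exists and is equal to `v`. That is,
`X √ρ` is everywhere defined and bounded (`= R`), `Y` is densely defined and `√ρ Y` extends
to a bounded operator (`= L`), and `L R` is of trace class with trace `v`. -/
def HasExpectation (ρ : E →L[ℂ] E) (Y X : E →ₗ.[ℂ] E) (v : ℂ) : Prop :=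
  Dense (Y.domain : Set E) ∧
    ∃ L R : E →L[ℂ] E,
      (∀ u : E, ∃ h : CFC.sqrt ρ u ∈ X.domain, R u = X ⟨CFC.sqrt ρ u, h⟩) ∧
      (∀ y : Y.domain, L y = CFC.sqrt ρ (Y y)) ∧
      HasTrace (L ∘L R) v

end States

/-! ### Two subsystems -/

section Bipartite

variable (H₁ H₂ : Type*) [NormedAddCommGroup H₁] [InnerProductSpace ℂ H₁]
  [NormedAddCommGroup H₂] [InnerProductSpace ℂ H₂]

/-- The Hilbert space of the composite system: the Hilbert space tensor product of `H₁` and `H₂`,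
i.e. the completion of the algebraic tensor product for `⟨x ⊗ y, x' ⊗ y'⟩ = ⟨x, x'⟩ ⟨y, y'⟩`. -/
abbrev Composite : Type _ := UniformSpace.Completion (H₁ ⊗[ℂ] H₂)

variable {H₁ H₂}

/-- The product vector `x ⊗ y` of the composite system. -/
def prodVec (x : H₁) (y : H₂) : Composite H₁ H₂ := ((x ⊗ₜ[ℂ] y : H₁ ⊗[ℂ] H₂) : Composite H₁ H₂)

/-- For `S` acting on the first and `T` on the second subsystem, the operator `S + T` of the
composite system, i.e. `S ⊗ 1 + 1 ⊗ T`: the closure of the operator that maps `x ⊗ y` to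
`S x ⊗ y + x ⊗ T y` on the linear span of the product vectors with `x ∈ dom S`, `y ∈ dom T`. -/
def opSum (S : H₁ →ₗ.[ℂ] H₁) (T : H₂ →ₗ.[ℂ] H₂) : Composite H₁ H₂ →ₗ.[ℂ] Composite H₁ H₂ :=
  (Submodule.span ℂ (Set.range fun z : S.domain × T.domain =>
    (prodVec (z.1 : H₁) (z.2 : H₂),
      prodVec (S z.1) (z.2 : H₂) + prodVec (z.1 : H₁) (T z.2)))).topologicalClosure.toLinearPMap

/-- The operator `ρ₁ ⊗ ρ₂` of the composite system, for bounded `ρ₁` and `ρ₂`. -/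
def opTensor (ρ₁ : H₁ →L[ℂ] H₁) (ρ₂ : H₂ →L[ℂ] H₂) : Composite H₁ H₂ →L[ℂ] Composite H₁ H₂ :=
  (TensorProduct.mapL ρ₁ ρ₂).completion

/-- Bipartite separable states: density operators `ρ = ∑ pᵢ ρ₁ᵢ ⊗ ρ₂ᵢ`, a finite or countable
convex combination of products of density operators of the two subsystems. (Finite
combinations have `pᵢ = 0` for almost all `i`.) -/
def IsSeparable [CompleteSpace H₁] [CompleteSpace H₂]
    (ρ : Composite H₁ H₂ →L[ℂ] Composite H₁ H₂) : Prop :=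
  IsDensityOperator ρ ∧
    ∃ (p : ℕ → ℝ) (ρ₁ : ℕ → H₁ →L[ℂ] H₁) (ρ₂ : ℕ → H₂ →L[ℂ] H₂),
      (∀ i, 0 ≤ p i) ∧ HasSum p 1 ∧
      (∀ i, IsDensityOperator (ρ₁ i)) ∧ (∀ i, IsDensityOperator (ρ₂ i)) ∧
      HasSum (fun i => (p i : ℂ) • opTensor (ρ₁ i) (ρ₂ i)) ρ

end Bipartite

end Separability

end

/-! Write `Q = √ρ`, `X = (A + B†)^n` and `R = X Q`. Since `(A† + B)^n` is formally adjoint to `X`,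
the expectation value is the squared Hilbert-Schmidt norm of `R` (`HasExpectation.exists_hasSum`),
hence real.

Reduction to product vectors (`IsSeparable.le_of_forall_prodVec`): spectral decompositions are not
needed. Finitely many vectors `v = √p (√ρ₁ e ⊗ √ρ₂ e')` satisfy `∑ |v⟩⟨v| ≤ Q²`, so `v = Q w` with
`∑ |w⟩⟨w| ≤ 1`, and `∑ ‖X v‖² = ∑ ‖R w‖²` is at most the expectation value. It remains to show `‖X
v‖² ≥ c^n n! ‖v‖²` for product vectors.

For `v = ξ ⊗ χ` the binomial theorem (`prodVec_mem_graph_opPow`) expresses `‖X v‖²` by the products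
`⟨a^(n-l) ξ, a^(n-k) ξ⟩ ⟨d^l χ, d^k χ⟩`. Normal ordering (`IsLadder.inner_pow_pow`) turns the second
factor into `∑_j j! C(l,j) C(k,j) c^j ⟨b^(k-j) χ, b^(l-j) χ⟩`. For fixed `j` this is a weighted
transposed Gram matrix, so by Schur's product theorem every `j` contributes a nonnegative amount,
and `j = n` contributes exactly `c^n n! ‖ξ‖² ‖χ‖²`.

The rest is domain control. `HasCommutator.isLadder` extends the commutation relation, as a form
identity, to all of `dom B†`. The maps `a`, `b`, `d` are arbitrary linear extensions of `A`, `B`,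
`B†`, so domain membership is tracked separately. -/

noncomputable section

namespace Separability

/-! ### Normal ordering for ladder operators -/

section Ladder

variable {E : Type*} [NormedAddCommGroup E] [InnerProductSpace ℂ E]

/-- The domain of the `n`-th power of `d`, when `d` is considered with domain `D`. -/
def iterDomain (d : E →ₗ[ℂ] E) (D : Submodule ℂ E) : ℕ → Submodule ℂ E
  | 0 => ⊤
  | n + 1 => D ⊓ (iterDomain d D n).comap d

theorem iterDomain_succ_le (d : E →ₗ[ℂ] E) (D : Submodule ℂ E) (n : ℕ) :
    iterDomain d D (n + 1) ≤ iterDomain d D n := by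
  induction n with
  | zero => exact le_top
  | succ n ih => exact fun u hu => ⟨hu.1, ih hu.2⟩

theorem iterDomain_antitone (d : E →ₗ[ℂ] E) (D : Submodule ℂ E) : Antitone (iterDomain d D) :=
  antitone_nat_of_succ_le (iterDomain_succ_le d D)

theorem pow_mem_iterDomain {d : E →ₗ[ℂ] E} {D : Submodule ℂ E} {n k : ℕ} {u : E}
    (hu : u ∈ iterDomain d D (n + k)) : (d ^ k) u ∈ iterDomain d D n := by
  induction k generalizing u with
  | zero => simpa using hu
  | succ k ih =>
    rw [pow_succ]
    exact ih hu.2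

theorem pow_mem_of_mem_iterDomain {d : E →ₗ[ℂ] E} {D : Submodule ℂ E} {n k : ℕ} {u : E}
    (hu : u ∈ iterDomain d D n) (hk : k < n) : (d ^ k) u ∈ D :=
  (pow_mem_iterDomain (n := 1) (iterDomain_antitone d D (by omega) hu)).1

theorem mem_iterDomain_succ {d : E →ₗ[ℂ] E} {D : Submodule ℂ E} {n : ℕ} {u : E}
    (hu : u ∈ iterDomain d D n) (h : (d ^ n) u ∈ D) : u ∈ iterDomain d D (n + 1) := by
  induction n generalizing u with
  | zero => exact ⟨h, trivial⟩
  | succ n ih => exact ⟨hu.1, ih hu.2 (by rwa [pow_succ] at h)⟩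

/-- `b` and `d` satisfy the canonical commutation relation `[b, d] = c` and are adjoint to
each other, on the domain `D` of `d`. -/
structure IsLadder (b d : E →ₗ[ℂ] E) (D : Submodule ℂ E) (c : ℝ) : Prop where
  adj : ∀ u ∈ D, ∀ v ∈ D, inner ℂ (d u) v = inner ℂ u (b v)
  -- This does not follow from `adj` and `comm`, since `d u` and `d v` may lie outside `D`.
  form : ∀ u ∈ D, ∀ v ∈ D,
    inner ℂ (d u) (d v) = inner ℂ (b u) (b v) + (c : ℂ) * inner ℂ u v
  mem : ∀ u ∈ D, d u ∈ D → b u ∈ D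
  comm : ∀ u ∈ D, d u ∈ D → b (d u) = d (b u) + (c : ℂ) • u

namespace IsLadder

variable {b d : E →ₗ[ℂ] E} {D : Submodule ℂ E} {c : ℝ}

theorem adj' (h : IsLadder b d D c) {u v : E} (hu : u ∈ D) (hv : v ∈ D) :
    inner ℂ (b u) v = inner ℂ u (d v) := by
  rw [← inner_conj_symm, ← h.adj v hv u hu, inner_conj_symm]

/-- Induction through `d b u = b d u - c u`, both terms of which lie one level deeper in the
domains. -/
theorem lower_mem (h : IsLadder b d D c) {n : ℕ} {u : E} (hu : u ∈ iterDomain d D (n + 1)) :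
    b u ∈ iterDomain d D n := by
  induction n generalizing u with
  | zero => trivial
  | succ n ih =>
    refine ⟨h.mem u hu.1 hu.2.1, ?_⟩
    have h1 := h.comm u hu.1 hu.2.1
    have h2 : d (b u) = b (d u) - (c : ℂ) • u := by rw [h1]; abel
    change d (b u) ∈ iterDomain d D n
    rw [h2]
    exact sub_mem (ih hu.2) (Submodule.smul_mem _ _ (iterDomain_antitone d D (by omega) hu))

theorem lower_pow (h : IsLadder b d D c) {k : ℕ} {u : E} (hu : u ∈ iterDomain d D (k + 1)) :
    b ((d ^ k) u) = (d ^ k) (b u) + ((k : ℂ) * c) • (d ^ (k - 1)) u := by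
  induction k generalizing u with
  | zero => simp
  | succ k ih =>
    have h1 := ih hu.2
    have h2 := h.comm u hu.1 hu.2.1
    rw [pow_succ]
    simp only [Module.End.mul_apply]
    rw [h1, h2, map_add, map_smul, add_assoc]
    congr 1
    rcases k with _ | k
    · simp
    · have : (d ^ k) (d u) = (d ^ (k + 1)) u := by rw [pow_succ]; rfl
      simp only [Nat.add_sub_cancel, this]
      rw [← add_smul]
      push_cast
      congr 1
      ring

end IsLadder

/-- The normally ordered form of `⟨dˡ ψ, dᵏ χ⟩` for ladder operators, summed up to `M`. -/
def normalOrdered (b : E →ₗ[ℂ] E) (c : ℂ) (M l k : ℕ) (ψ χ : E) : ℂ :=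
  ∑ j ∈ Finset.range M, ((j ! * l.choose j * k.choose j : ℕ) : ℂ) * c ^ j *
    inner ℂ ((b ^ (k - j)) ψ) ((b ^ (l - j)) χ)

/-- Pascal's rule in `l`, combined with `k C(k-1, j) = (j+1) C(k, j+1)`. The index shift lowers the
cutoff of the second sum, which is why `M` is a free parameter. -/
theorem normalOrdered_succ_left (b : E →ₗ[ℂ] E) (c : ℂ) (M l k : ℕ) (ψ χ : E) :
    normalOrdered b c (M + 1) (l + 1) k ψ χ =
      normalOrdered b c (M + 1) l k ψ (b χ) + k * c * normalOrdered b c M l (k - 1) ψ χ := by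
  unfold normalOrdered
  rw [Finset.sum_range_succ', Finset.sum_range_succ', Finset.mul_sum, add_right_comm,
    ← Finset.sum_add_distrib]
  congr 1
  · refine Finset.sum_congr rfl fun j _ => ?_
    have e1 : l + 1 - (j + 1) = l - j := by omega
    have e2 : k - 1 - j = k - (j + 1) := by omega
    have hk : ((k * (k - 1).choose j : ℕ) : ℂ) = ((k.choose (j + 1) * (j + 1) : ℕ) : ℂ) := by
      rcases k with _ | k
      · simp
      · rw [Nat.add_sub_cancel, Nat.add_one_mul_choose_eq]
    -- The truncated subtraction loses a power of `b` only where the binomial coefficient vanishes.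
    have hl : ((l.choose (j + 1) : ℕ) : ℂ) * inner ℂ ((b ^ (k - (j + 1))) ψ)
        ((b ^ (l - (j + 1))) (b χ)) = ((l.choose (j + 1) : ℕ) : ℂ) *
        inner ℂ ((b ^ (k - (j + 1))) ψ) ((b ^ (l - j)) χ) := by
      rcases lt_or_ge j l with hj | hj
      · rw [show l - j = (l - (j + 1)) + 1 by omega, pow_succ]; rfl
      · rw [Nat.choose_eq_zero_of_lt (by omega)]; simp
    rw [e1, e2, Nat.choose_succ_succ, Nat.factorial_succ]
    push_cast at hk hl ⊢
    linear_combination (-(((j + 1) * j ! * k.choose (j + 1) : ℂ)) * c ^ (j + 1)) * hl -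
      c * (j ! * l.choose j * c ^ j * inner ℂ ((b ^ (k - (j + 1))) ψ) ((b ^ (l - j)) χ)) * hk
  · simp [pow_succ]

theorem conj_normalOrdered (b : E →ₗ[ℂ] E) (c : ℝ) (M l k : ℕ) (ψ χ : E) :
    (starRingEnd ℂ) (normalOrdered b c M l k ψ χ) = normalOrdered b c M k l χ ψ := by
  unfold normalOrdered
  rw [map_sum]
  refine Finset.sum_congr rfl fun j _ => ?_
  rw [map_mul, map_mul, inner_conj_symm, map_natCast, map_pow, Complex.conj_ofReal]
  push_cast
  ring

theorem normalOrdered_succ_right (b : E →ₗ[ℂ] E) (c : ℝ) (M l k : ℕ) (ψ χ : E) :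
    normalOrdered b c (M + 1) l (k + 1) ψ χ =
      normalOrdered b c (M + 1) l k (b ψ) χ + l * c * normalOrdered b c M (l - 1) k ψ χ := by
  rw [← conj_normalOrdered, normalOrdered_succ_left]
  simp only [map_add, map_mul, conj_normalOrdered, map_natCast, Complex.conj_ofReal]

/-- Induction on `l + k`: one `d` crosses the inner product as `b` and is commuted through the other
power, matching the recursion of `normalOrdered`. Off the diagonal, conjugation symmetry allows
moving it from the higher power, so the other vector is in `D`. -/
theorem IsLadder.inner_pow_pow {b d : E →ₗ[ℂ] E} {D : Submodule ℂ E} {c : ℝ}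
    (h : IsLadder b d D c) {N M l k : ℕ} (hl : l ≤ N) (hk : k ≤ N) (hlM : l < M) (hkM : k < M)
    {ψ χ : E} (hψ : ψ ∈ iterDomain d D N) (hχ : χ ∈ iterDomain d D N) :
    inner ℂ ((d ^ l) ψ) ((d ^ k) χ) = normalOrdered b c M l k ψ χ := by
  induction hs : l + k using Nat.strong_induction_on generalizing N M l k ψ χ with
  | _ s ih =>
  obtain ⟨M, rfl⟩ : ∃ M', M = M' + 1 := ⟨M - 1, by omega⟩
  have key : ∀ {l k M N : ℕ} {ψ χ : E}, l + 1 + k = s → k ≤ l → l + 1 < M + 1 → k < M + 1 →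
      l + 1 ≤ N → ψ ∈ iterDomain d D N → χ ∈ iterDomain d D N →
      inner ℂ ((d ^ (l + 1)) ψ) ((d ^ k) χ) = normalOrdered b c (M + 1) (l + 1) k ψ χ := by
    intro l k M N ψ χ hs hkl hl hk hlN hψ hχ
    have hψ' := iterDomain_antitone d D hlN hψ
    have hχ' := iterDomain_antitone d D hlN hχ
    have hχ'' : χ ∈ iterDomain d D (k + 1) := iterDomain_antitone d D (by omega) hχ
    rw [normalOrdered_succ_left, pow_succ', Module.End.mul_apply,
      h.adj _ (pow_mem_of_mem_iterDomain hψ' (by omega)) _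
        (pow_mem_of_mem_iterDomain hχ'' (by omega)), h.lower_pow hχ'', inner_add_right,
      inner_smul_right]
    rw [ih (l + k) (by omega) (N := l) (M := M + 1) le_rfl hkl (by omega) (by omega)
        (iterDomain_succ_le d D l hψ') (h.lower_mem hχ') rfl]
    rcases k with _ | k
    · simp
    · rw [ih (l + (k + 1 - 1)) (by omega) (N := l) (M := M) le_rfl (by omega) (by omega) (by omega)
        (iterDomain_succ_le d D l hψ') (iterDomain_succ_le d D l hχ') rfl]
  rcases lt_trichotomy l k with hlk | hlk | hlk
  · obtain ⟨k, rfl⟩ : ∃ k', k = k' + 1 := ⟨k - 1, by omega⟩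
    rw [← inner_conj_symm, key (by omega) (by omega) hkM hlM hk hχ hψ, conj_normalOrdered]
  · subst hlk
    rcases l with _ | l
    · simp only [normalOrdered]
      rw [Finset.sum_range_succ', Finset.sum_eq_zero (by simp)]
      simp
    -- On the diagonal the other vector `d^(l+1) χ` need not lie in `D`, so `form` replaces `adj`.
    · have hψ' := iterDomain_antitone d D hl hψ
      have hχ' := iterDomain_antitone d D hl hχ
      have hψl := pow_mem_of_mem_iterDomain hψ' (Nat.lt_succ_self l)
      have hχl := pow_mem_of_mem_iterDomain hχ' (Nat.lt_succ_self l)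
      have h0 : inner ℂ ((d ^ l) ψ) ((d ^ l) χ) = normalOrdered b c M l l ψ χ :=
        ih (l + l) (by omega) (N := l) (M := M) le_rfl le_rfl (by omega) (by omega)
          (iterDomain_succ_le d D l hψ') (iterDomain_succ_le d D l hχ') rfl
      have h1 : (l : ℂ) * inner ℂ (b ((d ^ l) ψ)) ((d ^ (l - 1)) χ) =
          l * normalOrdered b c M l l ψ χ := by
        rcases l with _ | l
        · simp
        · rw [Nat.add_sub_cancel, h.adj' hψl (pow_mem_of_mem_iterDomain hχ' (by omega)), ← h0,
            ← Module.End.mul_apply d, ← pow_succ']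
      -- The induction hypothesis is not available at `(l, l + 1)`: `b χ` is only known to be in the
      -- domain of `d^l`. Hence `b` is commuted through on the left instead.
      have h2 : inner ℂ (b ((d ^ l) ψ)) ((d ^ l) (b χ)) =
          normalOrdered b c (M + 1) l (l + 1) ψ (b χ) := by
        rw [normalOrdered_succ_right, h.lower_pow hψ', inner_add_left, inner_smul_left,
          ih (l + l) (by omega) (N := l) (M := M + 1) le_rfl le_rfl (by omega) (by omega)
            (h.lower_mem hψ') (h.lower_mem hχ') rfl]
        congr 1
        rcases l with _ | l
        · simp
        · rw [ih (l + 1 - 1 + (l + 1)) (by omega) (N := l + 1) (M := M) (by omega) le_rfl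
            (by omega) (by omega) (iterDomain_succ_le d D _ hψ') (h.lower_mem hχ') rfl]
          simp
      rw [normalOrdered_succ_left, ← h2, Nat.add_sub_cancel]
      conv_lhs => rw [pow_succ', Module.End.mul_apply, Module.End.mul_apply,
        h.form _ hψl _ hχl, h.lower_pow hχ', inner_add_right, inner_smul_right]
      rw [h0]
      push_cast
      linear_combination (c : ℂ) * h1
  · obtain ⟨l, rfl⟩ : ∃ l', l = l' + 1 := ⟨l - 1, by omega⟩
    exact key hs (by omega) hlM hkM hl hψ hχ

end Ladder

/-! ### Positivity of the normally ordered terms -/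

section Schur

variable {E F : Type*} [NormedAddCommGroup E] [InnerProductSpace ℂ E]
  [NormedAddCommGroup F] [InnerProductSpace ℂ F]

open scoped ComplexOrder in
-- Schur's product theorem for a Gram matrix and a transposed Gram matrix; the reversed indices of
-- `y` are those produced by normal ordering.
theorem re_sum_inner_mul_inner_nonneg {ι : Type*} (s : Finset ι) (α : ι → ℝ) (x : ι → E)
    (y : ι → F) :
    0 ≤ (∑ l ∈ s, ∑ k ∈ s, (α l : ℂ) * α k * (inner ℂ (x l) (x k) * inner ℂ (y k) (y l))).re := by
  classical
  have hx := Matrix.posSemidef_gram ℂ (fun i : s => x i)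
  have hy := (Matrix.posSemidef_gram ℂ (fun i : s => y i)).transpose
  have h := (hx.hadamard hy).dotProduct_mulVec_nonneg (fun i : s => (α i : ℂ))
  have h' := (Complex.le_def.1 h).1
  rw [Complex.zero_re] at h'
  refine h'.trans_eq (congrArg Complex.re ?_)
  symm
  simp only [dotProduct, Matrix.mulVec, Matrix.hadamard_apply, Matrix.gram_apply,
    Matrix.transpose_apply, Pi.star_apply, Finset.mul_sum, RCLike.star_def, Complex.conj_ofReal]
  rw [← Finset.sum_coe_sort]
  refine Finset.sum_congr rfl fun l _ => ?_
  rw [← Finset.sum_coe_sort]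
  refine Finset.sum_congr rfl fun k _ => ?_
  ring

/-- The `n`-th power of `a ⊗ 1 + 1 ⊗ d` on a product vector, by the binomial theorem. -/
def binomialTensor (a : E →ₗ[ℂ] E) (d : F →ₗ[ℂ] F) (n : ℕ) (ξ : E) (χ : F) : E ⊗[ℂ] F :=
  ∑ k ∈ Finset.range (n + 1), ((n.choose k : ℂ) • (a ^ (n - k)) ξ) ⊗ₜ[ℂ] (d ^ k) χ

theorem IsLadder.le_norm_binomialTensor_sq {b d : F →ₗ[ℂ] F} {D : Submodule ℂ F} {c : ℝ}
    (h : IsLadder b d D c) (hc : 0 ≤ c) (a : E →ₗ[ℂ] E) {n : ℕ} (ξ : E) {χ : F}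
    (hχ : χ ∈ iterDomain d D n) :
    c ^ n * n ! * (‖ξ‖ ^ 2 * ‖χ‖ ^ 2) ≤ ‖binomialTensor a d n ξ χ‖ ^ 2 := by
  set T : ℕ → ℝ := fun j => (∑ l ∈ Finset.range (n + 1), ∑ k ∈ Finset.range (n + 1),
    (((n.choose l * l.choose j : ℕ) : ℝ) : ℂ) * ((n.choose k * k.choose j : ℕ) : ℝ) *
      (inner ℂ ((a ^ (n - l)) ξ) ((a ^ (n - k)) ξ) *
        inner ℂ ((b ^ (k - j)) χ) ((b ^ (l - j)) χ))).re with hT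
  have hT0 : ∀ j, 0 ≤ T j := fun j =>
    re_sum_inner_mul_inner_nonneg (Finset.range (n + 1)) _ _ _
  -- For `j = n` the binomials `C(l, n)` and `C(k, n)` leave only `l = k = n`.
  have hTn : T n = ‖ξ‖ ^ 2 * ‖χ‖ ^ 2 := by
    simp only [hT]
    rw [Finset.sum_eq_single_of_mem n (by simp), Finset.sum_eq_single_of_mem n (by simp)]
    · simp only [Nat.choose_self, Nat.sub_self, pow_zero, Module.End.one_apply,
        inner_self_eq_norm_sq_to_K]
      rw [← Complex.ofReal_re (‖ξ‖ ^ 2 * ‖χ‖ ^ 2)]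
      simp only [Nat.cast_one, Complex.ofReal_one, one_mul]
      push_cast
      rfl
    · intro k hk hkn
      rw [Nat.choose_eq_zero_of_lt (n := k) (k := n)
        (by have := Finset.mem_range.1 hk; omega)]
      simp
    · intro l hl hln
      rw [Nat.choose_eq_zero_of_lt (n := l) (k := n)
        (by have := Finset.mem_range.1 hl; omega)]
      simp
  have hmain : ‖binomialTensor a d n ξ χ‖ ^ 2 =
      ∑ j ∈ Finset.range (n + 1), (j ! * c ^ j) * T j := by
    have h1 : ‖binomialTensor a d n ξ χ‖ ^ 2 =
        (inner ℂ (binomialTensor a d n ξ χ) (binomialTensor a d n ξ χ)).re :=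
      (inner_self_eq_norm_sq (𝕜 := ℂ) _).symm
    have h2 : inner ℂ (binomialTensor a d n ξ χ) (binomialTensor a d n ξ χ) =
        ∑ j ∈ Finset.range (n + 1), ((j ! * c ^ j : ℝ) : ℂ) *
          ∑ l ∈ Finset.range (n + 1), ∑ k ∈ Finset.range (n + 1),
          (((n.choose l * l.choose j : ℕ) : ℝ) : ℂ) * ((n.choose k * k.choose j : ℕ) : ℝ) *
          (inner ℂ ((a ^ (n - l)) ξ) ((a ^ (n - k)) ξ) *
            inner ℂ ((b ^ (k - j)) χ) ((b ^ (l - j)) χ)) := by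
      simp only [binomialTensor, sum_inner, inner_sum, inner_smul_left, inner_smul_right,
        TensorProduct.inner_tmul, Finset.mul_sum]
      rw [Finset.sum_comm]
      conv_rhs => rw [Finset.sum_comm]
      refine Finset.sum_congr rfl fun l hl => ?_
      conv_rhs => rw [Finset.sum_comm]
      refine Finset.sum_congr rfl fun k hk => ?_
      rw [Finset.mem_range] at hl hk
      rw [h.inner_pow_pow (N := n) (M := n + 1) (by omega) (by omega) hl hk hχ hχ, normalOrdered,
        Finset.mul_sum]
      refine Finset.sum_congr rfl fun j _ => ?_
      rw [map_natCast]
      push_cast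
      ring
    rw [h1, h2, Complex.re_sum]
    refine Finset.sum_congr rfl fun j _ => ?_
    rw [Complex.re_ofReal_mul]
  rw [hmain, ← hTn, mul_comm (c ^ n)]
  exact Finset.single_le_sum (f := fun j => ((j ! : ℝ) * c ^ j) * T j)
    (fun j _ => mul_nonneg (by positivity) (hT0 j)) (by simp)

end Schur

theorem eq_zero_of_inner_self_add_inner_self {E : Type*} [NormedAddCommGroup E]
    [InnerProductSpace ℂ E] {x y : E}
    (h : inner ℂ x x + inner ℂ y y = (0 : ℂ)) : x = 0 ∧ y = 0 := by
  have hx : 0 ≤ (inner ℂ x x).re := inner_self_nonneg (𝕜 := ℂ)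
  have hy : 0 ≤ (inner ℂ y y).re := inner_self_nonneg (𝕜 := ℂ)
  have h' := congrArg Complex.re h
  rw [Complex.add_re, Complex.zero_re] at h'
  refine ⟨re_inner_self_nonpos (𝕜 := ℂ) |>.1 ?_, re_inner_self_nonpos (𝕜 := ℂ) |>.1 ?_⟩
  · change (inner ℂ x x).re ≤ 0
    linarith
  · change (inner ℂ y y).re ≤ 0
    linarith

/-! ### Adjoints and cores of closed operators -/

section ClosedOperators

variable {E : Type*} [NormedAddCommGroup E] [InnerProductSpace ℂ E] [CompleteSpace E]

/-- Orthogonal decomposition of a pair of vectors along a closed subspace. -/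
theorem exists_orthogonal_decomposition {G : Submodule ℂ (E × E)} (hG : IsClosed (G : Set (E × E)))
    (x y : E) : ∃ u v : E, (u, v) ∈ G ∧
      ∀ u' v', (u', v') ∈ G → inner ℂ u' (x - u) + inner ℂ v' (y - v) = 0 := by
  set e := WithLp.prodContinuousLinearEquiv 2 ℂ E E
  set K : Submodule ℂ (WithLp 2 (E × E)) := G.comap e.toLinearMap
  have hK : IsClosed (K : Set (WithLp 2 (E × E))) := hG.preimage e.continuous
  have : CompleteSpace K := hK.completeSpace_coe
  set p : WithLp 2 (E × E) := e.symm (x, y) with hp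
  refine ⟨(e (K.starProjection p)).1, (e (K.starProjection p)).2,
    K.starProjection_apply_mem p, fun u' v' h => ?_⟩
  have h1 : e.symm (u', v') ∈ K := by simpa [K] using h
  have h2 := Submodule.inner_right_of_mem_orthogonal h1
    (K.sub_starProjection_mem_orthogonal p)
  rw [WithLp.prod_inner_apply] at h2
  exact h2

theorem mem_adjoint_of_orthogonal {T : E →ₗ.[ℂ] E} (hT : Dense (T.domain : Set E)) {x y : E}
    (h : ∀ u v, (u, v) ∈ T.graph → inner ℂ u x + inner ℂ v y = 0) : (y, -x) ∈ T†.graph := by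
  rw [LinearPMap.adjoint_graph_eq_graph_adjoint hT, Submodule.mem_adjoint_iff]
  intro u v huv
  have := h u v huv
  simp only [inner_neg_right, sub_neg_eq_add]
  rw [add_comm]
  exact this

theorem inner_graph_adjoint {T : E →ₗ.[ℂ] E} (hT : Dense (T.domain : Set E)) {u v y z : E}
    (h : (u, v) ∈ T.graph) (h' : (y, z) ∈ T†.graph) : inner ℂ v y = inner ℂ u z := by
  rw [LinearPMap.adjoint_graph_eq_graph_adjoint hT, Submodule.mem_adjoint_iff] at h'
  exact sub_eq_zero.1 (h' u v h)

/-- For `z` orthogonal to `dom T†`, project `(0, z)` onto the graph of `T`. The residual yields an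
element of the graph of `T†`; pairing it with `z` and with the projection forces the residual to
vanish, so `z = T 0`. -/
theorem dense_adjoint_domain {T : E →ₗ.[ℂ] E} (hT : Dense (T.domain : Set E))
    (hT' : T.IsClosed) : Dense (T†.domain : Set E) := by
  rw [Submodule.dense_iff_topologicalClosure_eq_top,
    Submodule.topologicalClosure_eq_top_iff, Submodule.eq_bot_iff]
  intro z hz
  obtain ⟨u, v, huv, h⟩ := exists_orthogonal_decomposition hT' 0 z
  have hy := mem_adjoint_of_orthogonal hT h
  have h1 : inner ℂ (z - v) z = 0 :=
    Submodule.inner_right_of_mem_orthogonal (LinearPMap.mem_domain_of_mem_graph hy) hz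
  have h2 := inner_graph_adjoint hT huv hy
  have h3 : inner ℂ (z - v) v = inner ℂ u u := by
    rw [← inner_conj_symm, h2]
    simp
  have h4 : inner ℂ (z - v) (z - v) + inner ℂ u u = (0 : ℂ) := by
    rw [← h3, ← inner_add_right, sub_add_cancel, h1]
  obtain ⟨h7, h6⟩ := eq_zero_of_inner_self_add_inner_self h4
  rw [sub_eq_zero.1 h7, T.graph_fst_eq_zero_snd huv h6]

theorem adjoint_adjoint_domain_le {T : E →ₗ.[ℂ] E} (hT : Dense (T.domain : Set E))
    (hT' : T.IsClosed) : T††.domain ≤ T.domain := by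
  intro x hx
  obtain ⟨y, hxy⟩ := LinearPMap.mem_domain_iff.1 hx
  obtain ⟨u, v, huv, h⟩ := exists_orthogonal_decomposition hT' x y
  have hy := mem_adjoint_of_orthogonal hT h
  have h2 := inner_graph_adjoint hT huv hy
  have h3 := inner_graph_adjoint (dense_adjoint_domain hT hT') hy hxy
  have h4 : inner ℂ (x - u) (x - u) + inner ℂ (y - v) (y - v) = (0 : ℂ) := by
    have h5 : inner ℂ (y - v) v = inner ℂ (-(x - u)) u := by
      rw [← inner_conj_symm, h2, inner_conj_symm]
    rw [inner_sub_right (y - v), h5, ← h3, ← inner_sub_right, inner_neg_left, add_neg_cancel]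
  rw [sub_eq_zero.1 (eq_zero_of_inner_self_add_inner_self h4).1]
  exact LinearPMap.mem_domain_of_mem_graph huv

/-- The domain of `T† T` is a core of the closed operator `T`. -/
theorem mem_closure_graph_core {T : E →ₗ.[ℂ] E} (hT : Dense (T.domain : Set E))
    (hT' : T.IsClosed) {x y : E} (hxy : (x, y) ∈ T.graph) :
    (x, y) ∈ closure {p : E × E | p ∈ T.graph ∧ p.2 ∈ T†.domain} := by
  set G : Submodule ℂ (E × E) :=
    T.graph ⊓ T†.domain.comap (LinearMap.snd ℂ E E) with hG
  have hset : {p : E × E | p ∈ T.graph ∧ p.2 ∈ T†.domain} = (G : Set (E × E)) := rfl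
  rw [hset, ← Submodule.topologicalClosure_coe]
  obtain ⟨u, v, huv, h⟩ :=
    exists_orthogonal_decomposition G.isClosed_topologicalClosure x y
  have hGT : G.topologicalClosure ≤ T.graph :=
    Submodule.topologicalClosure_minimal _ inf_le_left hT'
  have hsub : (x - u, y - v) ∈ T.graph := sub_mem hxy (hGT huv)
  -- Projecting `(x - u, 0)` onto the graph solves `(1 + T† T) p = x - u`. As `(p, T p)` lies in the
  -- restricted graph, orthogonality to it reads `‖x - u‖² = 0`.
  obtain ⟨p, q, hpq, h'⟩ := exists_orthogonal_decomposition hT' (x - u) 0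
  have hq := mem_adjoint_of_orthogonal hT h'
  rw [zero_sub] at hq
  have hqd : q ∈ T†.domain := by
    have := LinearPMap.mem_domain_of_mem_graph hq
    simpa using this
  have h1 := h p q (G.le_topologicalClosure ⟨hpq, hqd⟩)
  have h2 := inner_graph_adjoint hT hsub hq
  have h3 : inner ℂ (x - u) (x - u) = (0 : ℂ) := by
    have h4 : inner ℂ q (y - v) = inner ℂ (x - u - p) (x - u) := by
      rw [← inner_conj_symm, ← inner_conj_symm (x - u - p)]
      rw [inner_neg_right, inner_neg_right] at h2
      rw [neg_inj.1 h2]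
    rw [h4, ← inner_add_left] at h1
    simpa using h1
  have h5 : x - u = 0 := inner_self_eq_zero.1 h3
  have h6 : y - v = 0 := T.graph_fst_eq_zero_snd hsub h5
  rw [sub_eq_zero.1 h5, sub_eq_zero.1 h6]
  exact huv

end ClosedOperators

/-- A partially defined linear map extends to a linear map of the whole space. -/
theorem exists_linearMap_extension {E : Type*} [AddCommGroup E] [Module ℂ E] (T : E →ₗ.[ℂ] E) :
    ∃ t : E →ₗ[ℂ] E, ∀ (u : E) (h : u ∈ T.domain), T ⟨u, h⟩ = t u := by
  obtain ⟨t, ht⟩ := T.toFun.exists_extend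
  exact ⟨t, fun u h => (LinearMap.congr_fun ht ⟨u, h⟩).symm⟩

theorem mk_mem_graph {E : Type*} [AddCommGroup E] [Module ℂ E] {T : E →ₗ.[ℂ] E} {t : E →ₗ[ℂ] E}
    (ht : ∀ (u : E) (h : u ∈ T.domain), T ⟨u, h⟩ = t u) {u : E} (h : u ∈ T.domain) :
    (u, t u) ∈ T.graph := by
  rw [← ht u h]
  exact T.mem_graph ⟨u, h⟩

theorem eq_of_mem_graph {E : Type*} [AddCommGroup E] [Module ℂ E] {T : E →ₗ.[ℂ] E}
    {t : E →ₗ[ℂ] E} (ht : ∀ (u : E) (h : u ∈ T.domain), T ⟨u, h⟩ = t u) {u v : E}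
    (h : (u, v) ∈ T.graph) : v = t u :=
  T.mem_graph_snd_inj h (mk_mem_graph ht (LinearPMap.mem_domain_of_mem_graph h)) rfl

/-! ### From the operator identity to the ladder relations -/

section Commutator

open Filter Topology

variable {E : Type*} [NormedAddCommGroup E] [InnerProductSpace ℂ E] [CompleteSpace E]
  {B : E →ₗ.[ℂ] E} {b d : E →ₗ[ℂ] E} {c : ℝ}

theorem inner_adjoint_extension (hB : Dense (B.domain : Set E))
    (hb : ∀ (u : E) (h : u ∈ B.domain), B ⟨u, h⟩ = b u)
    (hd : ∀ (u : E) (h : u ∈ B†.domain), B† ⟨u, h⟩ = d u) {u v : E} (hu : u ∈ B†.domain)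
    (hv : v ∈ B.domain) : inner ℂ (d u) v = inner ℂ u (b v) := by
  rw [← hb v hv, ← hd u hu]
  exact LinearPMap.adjoint_isFormalAdjoint hB ⟨u, hu⟩ ⟨v, hv⟩

theorem HasCommutator.apply_extension (hcomm : HasCommutator B B† (c : ℂ))
    (hb : ∀ (u : E) (h : u ∈ B.domain), B ⟨u, h⟩ = b u)
    (hd : ∀ (u : E) (h : u ∈ B†.domain), B† ⟨u, h⟩ = d u) {u : E} (hu : u ∈ B†.domain)
    (hdu : d u ∈ B.domain) :
    u ∈ B.domain ∧ b u ∈ B†.domain ∧ b (d u) = d (b u) + (c : ℂ) • u := by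
  have hdu' : B† ⟨u, hu⟩ ∈ B.domain := by rwa [hd]
  have h1 : u ∈ (opMul B B†).domain := (mem_opMul_domain _ _ _).2 ⟨hu, hdu'⟩
  have h2 : u ∈ (opMul B† B).domain := hcomm.1 ▸ h1
  obtain ⟨hu', hbu'⟩ := (mem_opMul_domain _ _ _).1 h2
  have h3 := hcomm.2 u h1 h2
  rw [opMul_apply _ _ _ hu hdu' h1, opMul_apply _ _ _ hu' hbu' h2, hb, hd, hd, hb] at h3
  exact ⟨hu', by rwa [hb] at hbu', by rw [← h3]; abel⟩

theorem HasCommutator.form_core (hB : Dense (B.domain : Set E))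
    (hcomm : HasCommutator B B† (c : ℂ))
    (hb : ∀ (u : E) (h : u ∈ B.domain), B ⟨u, h⟩ = b u)
    (hd : ∀ (u : E) (h : u ∈ B†.domain), B† ⟨u, h⟩ = d u) {u v : E} (hu : u ∈ B†.domain)
    (hdu : d u ∈ B.domain) (hv : v ∈ B†.domain) (hdv : d v ∈ B.domain) :
    inner ℂ (d u) (d v) = inner ℂ (b u) (b v) + (c : ℂ) * inner ℂ u v := by
  obtain ⟨hu', hbu, -⟩ := hcomm.apply_extension hb hd hu hdu
  obtain ⟨hv', hbv, h⟩ := hcomm.apply_extension hb hd hv hdv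
  rw [inner_adjoint_extension hB hb hd hu hdv, h, inner_add_right, inner_smul_right,
    ← inner_conj_symm u (d (b v)), inner_adjoint_extension hB hb hd hbv hu', inner_conj_symm]

/-- On the core `dom (B B†)` of `B†` the form identity with `c ≥ 0` gives `‖B z‖ ≤ ‖B† z‖`.
Convergence in the graph norm of `B†` therefore makes `B z` Cauchy, and closedness of `B` puts the
limit in `dom B`. -/
theorem HasCommutator.exists_core_seq (hB : Dense (B.domain : Set E)) (hB' : B.IsClosed)
    (hc : 0 ≤ c) (hcomm : HasCommutator B B† (c : ℂ))
    (hb : ∀ (u : E) (h : u ∈ B.domain), B ⟨u, h⟩ = b u)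
    (hd : ∀ (u : E) (h : u ∈ B†.domain), B† ⟨u, h⟩ = d u) {u : E} (hu : u ∈ B†.domain) :
    u ∈ B.domain ∧ ∃ z : ℕ → E, (∀ k, z k ∈ B†.domain ∧ d (z k) ∈ B.domain) ∧
      Tendsto z atTop (𝓝 u) ∧ Tendsto (fun k => d (z k)) atTop (𝓝 (d u)) ∧
      Tendsto (fun k => b (z k)) atTop (𝓝 (b u)) := by
  have hmem := mem_closure_graph_core (dense_adjoint_domain hB hB')
    (LinearPMap.adjoint_isClosed hB) (mk_mem_graph hd hu)
  obtain ⟨p, hp, hlim⟩ := mem_closure_iff_seq_limit.1 hmem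
  have hz : ∀ k, (p k).1 ∈ B†.domain ∧ d (p k).1 ∈ B.domain := fun k => by
    refine ⟨LinearPMap.mem_domain_of_mem_graph (y := (p k).2) (hp k).1, ?_⟩
    rw [← eq_of_mem_graph hd (v := (p k).2) (hp k).1]
    exact adjoint_adjoint_domain_le hB hB' (hp k).2
  have hpd : ∀ k, (p k).2 = d (p k).1 := fun k => eq_of_mem_graph hd (hp k).1
  have hl1 : Tendsto (fun k => (p k).1) atTop (𝓝 u) := (continuous_fst.tendsto _).comp hlim
  have hl2 : Tendsto (fun k => d (p k).1) atTop (𝓝 (d u)) := by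
    simp_rw [← hpd]
    exact (continuous_snd.tendsto _).comp hlim
  have hle : ∀ j k, ‖b (p j).1 - b (p k).1‖ ≤ ‖d (p j).1 - d (p k).1‖ := fun j k => by
    have hs1 : (p j).1 - (p k).1 ∈ B†.domain := sub_mem (hz j).1 (hz k).1
    have hs2 : d ((p j).1 - (p k).1) ∈ B.domain := by
      rw [map_sub]
      exact sub_mem (hz j).2 (hz k).2
    have h := congrArg Complex.re (hcomm.form_core hB hb hd hs1 hs2 hs1 hs2)
    rw [Complex.add_re, Complex.re_ofReal_mul] at h
    have e : ∀ v : E, (inner ℂ v v).re = ‖v‖ ^ 2 := fun v => inner_self_eq_norm_sq (𝕜 := ℂ) v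
    rw [e, e, e, map_sub, map_sub] at h
    refine le_of_sq_le_sq ?_ (norm_nonneg _)
    rw [h]
    have := mul_nonneg hc (sq_nonneg ‖(p j).1 - (p k).1‖)
    linarith
  have hcauchy : CauchySeq fun k => b (p k).1 := by
    rw [Metric.cauchySeq_iff]
    intro ε hε
    obtain ⟨N, hN⟩ := Metric.cauchySeq_iff.1 hl2.cauchySeq ε hε
    refine ⟨N, fun m hm n hn => lt_of_le_of_lt ?_ (hN m hm n hn)⟩
    rw [dist_eq_norm, dist_eq_norm]
    exact hle m n
  obtain ⟨w, hw⟩ := cauchySeq_tendsto_of_complete hcauchy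
  have hzB : ∀ k, (p k).1 ∈ B.domain := fun k =>
    (hcomm.apply_extension hb hd (hz k).1 (hz k).2).1
  have hgr : (u, w) ∈ B.graph :=
    IsClosed.mem_of_tendsto hB' (hl1.prodMk_nhds hw)
      (Eventually.of_forall fun k => mk_mem_graph hb (hzB k))
  have hwb := eq_of_mem_graph hb hgr
  exact ⟨LinearPMap.mem_domain_of_mem_graph hgr, fun k => (p k).1, hz, hl1, hl2, hwb ▸ hw⟩

theorem HasCommutator.isLadder (hB : Dense (B.domain : Set E)) (hB' : B.IsClosed)
    (hc : 0 ≤ c) (hcomm : HasCommutator B B† (c : ℂ))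
    (hb : ∀ (u : E) (h : u ∈ B.domain), B ⟨u, h⟩ = b u)
    (hd : ∀ (u : E) (h : u ∈ B†.domain), B† ⟨u, h⟩ = d u) : IsLadder b d B†.domain c where
  adj u hu v hv :=
    inner_adjoint_extension hB hb hd hu (hcomm.exists_core_seq hB hB' hc hb hd hv).1
  form u hu v hv := by
    obtain ⟨-, z, hz, hz1, hz2, hz3⟩ := hcomm.exists_core_seq hB hB' hc hb hd hu
    obtain ⟨-, y, hy, hy1, hy2, hy3⟩ := hcomm.exists_core_seq hB hB' hc hb hd hv
    refine tendsto_nhds_unique (hz2.inner hy2) ?_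
    refine (((hz3.inner hy3)).add ((hz1.inner hy1).const_mul (c : ℂ))).congr fun k => ?_
    exact (hcomm.form_core hB hb hd (hz k).1 (hz k).2 (hy k).1 (hy k).2).symm
  mem u hu hdu :=
    (hcomm.apply_extension hb hd hu (hcomm.exists_core_seq hB hB' hc hb hd hdu).1).2.1
  comm u hu hdu :=
    (hcomm.apply_extension hb hd hu (hcomm.exists_core_seq hB hB' hc hb hd hdu).1).2.2

end Commutator

/-! ### Graphs of powers -/

section Powers

variable {E : Type*} [NormedAddCommGroup E] [InnerProductSpace ℂ E]

theorem mem_graph_opMul {S T : E →ₗ.[ℂ] E} {u w : E} :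
    (u, w) ∈ (opMul S T).graph ↔ ∃ v, (u, v) ∈ T.graph ∧ (v, w) ∈ S.graph := by
  constructor
  · intro h
    have hu := LinearPMap.mem_domain_of_mem_graph h
    obtain ⟨h1, h2⟩ := (mem_opMul_domain S T u).1 hu
    refine ⟨T ⟨u, h1⟩, T.mem_graph ⟨u, h1⟩, ?_⟩
    have h3 := LinearPMap.mem_graph_snd_inj _ h ((opMul S T).mem_graph ⟨u, hu⟩) rfl
    rw [h3, opMul_apply S T u h1 h2 hu]
    exact S.mem_graph ⟨_, h2⟩
  · rintro ⟨v, h1, h2⟩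
    have hu := LinearPMap.mem_domain_of_mem_graph h1
    have hv := LinearPMap.mem_domain_of_mem_graph h2
    have e1 : v = T ⟨u, hu⟩ := LinearPMap.mem_graph_snd_inj _ h1 (T.mem_graph ⟨u, hu⟩) rfl
    subst e1
    have e2 := LinearPMap.mem_graph_snd_inj _ h2 (S.mem_graph ⟨_, hv⟩) rfl
    have h3 : u ∈ (opMul S T).domain := (mem_opMul_domain S T u).2 ⟨hu, hv⟩
    rw [e2, ← opMul_apply S T u hu hv h3]
    exact (opMul S T).mem_graph ⟨u, h3⟩

theorem mem_graph_opPow_zero {T : E →ₗ.[ℂ] E} {u w : E} :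
    (u, w) ∈ (opPow T 0).graph ↔ w = u := by
  rw [LinearPMap.mem_graph_iff]
  constructor
  · rintro ⟨y, h1, h2⟩
    exact h2.symm.trans h1
  · rintro rfl
    exact ⟨⟨w, trivial⟩, rfl, rfl⟩

theorem mem_graph_opPow_succ {T : E →ₗ.[ℂ] E} {n : ℕ} {u w : E} :
    (u, w) ∈ (opPow T (n + 1)).graph ↔ ∃ v, (u, v) ∈ (opPow T n).graph ∧ (v, w) ∈ T.graph :=
  mem_graph_opMul

theorem mem_graph_opPow_succ' {T : E →ₗ.[ℂ] E} {n : ℕ} {u w : E} :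
    (u, w) ∈ (opPow T (n + 1)).graph ↔ ∃ v, (u, v) ∈ T.graph ∧ (v, w) ∈ (opPow T n).graph := by
  induction n generalizing w with
  | zero =>
    rw [mem_graph_opPow_succ]
    simp_rw [mem_graph_opPow_zero]
    exact ⟨fun ⟨v, h1, h2⟩ => ⟨w, h1 ▸ h2, rfl⟩, fun ⟨v, h1, h2⟩ => ⟨u, rfl, h2 ▸ h1⟩⟩
  | succ n ih =>
    rw [mem_graph_opPow_succ]
    simp_rw [ih, mem_graph_opPow_succ (n := n)]
    constructor
    · rintro ⟨v, ⟨v', h1, h2⟩, h3⟩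
      exact ⟨v', h1, v, h2, h3⟩
    · rintro ⟨v, h1, v', h2, h3⟩
      exact ⟨v', ⟨v, h1, h2⟩, h3⟩

theorem inner_opPow_graph {S T : E →ₗ.[ℂ] E}
    (h : ∀ u w u' w', (u, w) ∈ T.graph → (u', w') ∈ S.graph → inner ℂ w' u = inner ℂ u' w)
    {n : ℕ} {u w u' w' : E} (hu : (u, w) ∈ (opPow T n).graph)
    (hu' : (u', w') ∈ (opPow S n).graph) : inner ℂ w' u = inner ℂ u' w := by
  induction n generalizing u w' with
  | zero => rw [mem_graph_opPow_zero.1 hu, mem_graph_opPow_zero.1 hu']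
  | succ n ih =>
    obtain ⟨v, h1, h2⟩ := mem_graph_opPow_succ'.1 hu
    obtain ⟨v', h1', h2'⟩ := mem_graph_opPow_succ.1 hu'
    -- The innermost factor of `T^(n+1)` is paired with the outermost factor of `S^(n+1)`.
    rw [h _ _ _ _ h1 h2', ih h2 h1']

end Powers

/-! ### The closed sum on the composite system -/

section OpSum

variable {H₁ H₂ : Type*} [NormedAddCommGroup H₁] [InnerProductSpace ℂ H₁]
  [NormedAddCommGroup H₂] [InnerProductSpace ℂ H₂]

theorem inner_prodVec (x x' : H₁) (y y' : H₂) :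
    inner ℂ (prodVec x y) (prodVec x' y') = inner ℂ x x' * inner ℂ y y' := by
  rw [prodVec, prodVec, UniformSpace.Completion.inner_coe, TensorProduct.inner_tmul]

theorem norm_prodVec (x : H₁) (y : H₂) : ‖prodVec x y‖ = ‖x‖ * ‖y‖ := by
  rw [prodVec, UniformSpace.Completion.norm_coe, TensorProduct.norm_tmul]

variable (H₂) in
/-- `x ↦ x ⊗ y` as a bounded operator. -/
def prodVecLeft (y : H₂) : H₁ →L[ℂ] Composite H₁ H₂ :=
  UniformSpace.Completion.toComplL ∘L ((TensorProduct.mkL ℂ H₁ H₂).flip y)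

/-- `y ↦ x ⊗ y` as a bounded operator. -/
def prodVecRight (x : H₁) : H₂ →L[ℂ] Composite H₁ H₂ :=
  UniformSpace.Completion.toComplL ∘L (TensorProduct.mkL ℂ H₁ H₂ x)

theorem prodVecLeft_apply (x : H₁) (y : H₂) : prodVecLeft H₂ y x = prodVec x y := rfl

theorem prodVecRight_apply (x : H₁) (y : H₂) : prodVecRight x y = prodVec x y := rfl

theorem eq_zero_of_inner_prodVec {X : Set H₁} {Y : Set H₂} (hX : Dense X) (hY : Dense Y)
    {w : Composite H₁ H₂} (h : ∀ x ∈ X, ∀ y ∈ Y, inner ℂ (prodVec x y) w = 0) : w = 0 := by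
  have h1 : ∀ x ∈ X, ∀ y, inner ℂ (prodVec x y) w = 0 := fun x hx =>
    congrFun (Continuous.ext_on hY
      (((prodVecRight (H₂ := H₂) x).continuous).inner continuous_const) continuous_const (h x hx))
  have h2 : ∀ x y, inner ℂ (prodVec x y) w = 0 := fun x y =>
    congrFun (Continuous.ext_on hX (f := fun x => inner ℂ (prodVec x y) w) (g := fun _ => 0)
      (((prodVecLeft H₂ y).continuous).inner continuous_const)
      continuous_const fun x hx => h1 x hx y) x
  have h3 : ∀ t : H₁ ⊗[ℂ] H₂, inner ℂ (t : Composite H₁ H₂) w = 0 := fun t => by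
    induction t using TensorProduct.induction_on with
    | zero => rw [UniformSpace.Completion.coe_zero, inner_zero_left]
    | tmul x y => exact h2 x y
    | add s t hs ht => rw [UniformSpace.Completion.coe_add, inner_add_left, hs, ht, add_zero]
  have h4 : ∀ v : Composite H₁ H₂, inner ℂ v w = 0 := fun v =>
    UniformSpace.Completion.induction_on v
      (isClosed_eq (continuous_id.inner continuous_const) continuous_const) h3
  exact inner_self_eq_zero.1 (h4 w)

/-- The closure of the graph of `S ⊗ 1 + 1 ⊗ T`. -/
def sumGraph (S : H₁ →ₗ.[ℂ] H₁) (T : H₂ →ₗ.[ℂ] H₂) :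
    Submodule ℂ (Composite H₁ H₂ × Composite H₁ H₂) :=
  (Submodule.span ℂ (Set.range fun z : S.domain × T.domain =>
    (prodVec (z.1 : H₁) (z.2 : H₂),
      prodVec (S z.1) (z.2 : H₂) + prodVec (z.1 : H₁) (T z.2)))).topologicalClosure

theorem opSum_eq (S : H₁ →ₗ.[ℂ] H₁) (T : H₂ →ₗ.[ℂ] H₂) :
    opSum S T = (sumGraph S T).toLinearPMap := rfl

/-- To be orthogonal (in the graph sense) to `S ⊗ 1 + 1 ⊗ T`, it suffices to test on product
vectors. -/
theorem inner_sumGraph {S : H₁ →ₗ.[ℂ] H₁} {T : H₂ →ₗ.[ℂ] H₂} {u' w' : Composite H₁ H₂}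
    (h : ∀ (x : S.domain) (y : T.domain),
      inner ℂ w' (prodVec (x : H₁) (y : H₂)) =
        inner ℂ u' (prodVec (S x) (y : H₂) + prodVec (x : H₁) (T y)))
    {u w : Composite H₁ H₂} (hu : (u, w) ∈ sumGraph S T) : inner ℂ w' u = inner ℂ u' w := by
  set K : Submodule ℂ (Composite H₁ H₂ × Composite H₁ H₂) :=
    LinearMap.ker ((innerSL ℂ w' ∘L ContinuousLinearMap.fst ℂ _ _) -
      (innerSL ℂ u' ∘L ContinuousLinearMap.snd ℂ _ _)).toLinearMap with hK
  have hKmem : ∀ p, p ∈ K ↔ inner ℂ w' p.1 = inner ℂ u' p.2 := fun p => by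
    rw [hK, LinearMap.mem_ker]
    exact sub_eq_zero
  have hKc : IsClosed (K : Set (Composite H₁ H₂ × Composite H₁ H₂)) :=
    ContinuousLinearMap.isClosed_ker ((innerSL ℂ w' ∘L ContinuousLinearMap.fst ℂ _ _) -
      (innerSL ℂ u' ∘L ContinuousLinearMap.snd ℂ _ _))
  have hle : sumGraph S T ≤ K := by
    refine Submodule.topologicalClosure_minimal _ (Submodule.span_le.2 ?_) hKc
    rintro _ ⟨⟨x, y⟩, rfl⟩
    exact (hKmem _).2 (h x y)
  exact (hKmem _).1 (hle hu)

variable {S S' : H₁ →ₗ.[ℂ] H₁} {T T' : H₂ →ₗ.[ℂ] H₂}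

theorem inner_sumGraph_prodVec (hS : S'.IsFormalAdjoint S) (hT : T'.IsFormalAdjoint T)
    {u w : Composite H₁ H₂} (hu : (u, w) ∈ sumGraph S T) (x' : S'.domain) (y' : T'.domain) :
    inner ℂ (prodVec (S' x') (y' : H₂) + prodVec (x' : H₁) (T' y')) u =
      inner ℂ (prodVec (x' : H₁) (y' : H₂)) w := by
  refine inner_sumGraph (fun x y => ?_) hu
  rw [inner_add_left, inner_add_right]
  simp only [inner_prodVec]
  rw [hS x' x, hT y' y]

/-- `toLinearPMap` keeps its subspace as graph only if that is single-valued. Here this is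
closability, which follows from the densely defined formal adjoint `S' + T'`. -/
theorem graph_opSum (hS : S'.IsFormalAdjoint S) (hT : T'.IsFormalAdjoint T)
    (hS' : Dense (S'.domain : Set H₁)) (hT' : Dense (T'.domain : Set H₂)) :
    (opSum S T).graph = sumGraph S T := by
  rw [opSum_eq, Submodule.toLinearPMap_graph_eq]
  rintro ⟨u, w⟩ hu rfl
  refine eq_zero_of_inner_prodVec hS' hT' fun x' hx' y' hy' => ?_
  have h := inner_sumGraph_prodVec hS hT hu ⟨x', hx'⟩ ⟨y', hy'⟩
  rw [← h]
  exact inner_zero_right _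

theorem inner_opSum_graph (hS : S'.IsFormalAdjoint S) (hT : T'.IsFormalAdjoint T)
    (hSd : Dense (S.domain : Set H₁)) (hTd : Dense (T.domain : Set H₂))
    (hS' : Dense (S'.domain : Set H₁)) (hT' : Dense (T'.domain : Set H₂))
    {u w u' w' : Composite H₁ H₂} (hu : (u, w) ∈ (opSum S T).graph)
    (hu' : (u', w') ∈ (opSum S' T').graph) : inner ℂ w' u = inner ℂ u' w := by
  rw [graph_opSum hS hT hS' hT'] at hu
  rw [graph_opSum hS.symm hT.symm hSd hTd] at hu'
  refine inner_sumGraph (fun x y => ?_) hu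
  rw [← inner_conj_symm, ← inner_conj_symm u', inner_sumGraph_prodVec hS.symm hT.symm hu' x y]

end OpSum

/-! ### Product vectors in the domain of a power -/

section ProductVectors

variable {H₁ H₂ : Type*} [NormedAddCommGroup H₁] [InnerProductSpace ℂ H₁] [CompleteSpace H₁]
  [NormedAddCommGroup H₂] [InnerProductSpace ℂ H₂] [CompleteSpace H₂]

theorem binomialTensor_eq_pow {E F : Type*} [NormedAddCommGroup E] [InnerProductSpace ℂ E]
    [NormedAddCommGroup F] [InnerProductSpace ℂ F] (a : E →ₗ[ℂ] E) (d : F →ₗ[ℂ] F) (n : ℕ)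
    (ξ : E) (χ : F) :
    binomialTensor a d n ξ χ = ((d.lTensor E + a.rTensor F) ^ n) (ξ ⊗ₜ[ℂ] χ) := by
  have hcomm : Commute (d.lTensor E) (a.rTensor F) := by
    change d.lTensor E ∘ₗ a.rTensor F = a.rTensor F ∘ₗ d.lTensor E
    rw [LinearMap.lTensor_comp_rTensor, LinearMap.rTensor_comp_lTensor]
  rw [hcomm.add_pow, LinearMap.sum_apply, binomialTensor]
  refine Finset.sum_congr rfl fun k _ => ?_
  rw [LinearMap.lTensor_pow, LinearMap.rTensor_pow, (Nat.cast_commute _ _).symm.eq,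
    ← nsmul_eq_mul, LinearMap.smul_apply, Module.End.mul_apply, LinearMap.rTensor_tmul,
    LinearMap.lTensor_tmul, ← Nat.cast_smul_eq_nsmul ℂ, TensorProduct.smul_tmul']

theorem binomialTensor_succ {E F : Type*} [NormedAddCommGroup E] [InnerProductSpace ℂ E]
    [NormedAddCommGroup F] [InnerProductSpace ℂ F] (a : E →ₗ[ℂ] E) (d : F →ₗ[ℂ] F) (n : ℕ)
    (ξ : E) (χ : F) :
    binomialTensor a d (n + 1) ξ χ = ∑ k ∈ Finset.range (n + 1),
      (((n.choose k : ℂ) • a ((a ^ (n - k)) ξ)) ⊗ₜ[ℂ] (d ^ k) χ +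
        ((n.choose k : ℂ) • (a ^ (n - k)) ξ) ⊗ₜ[ℂ] d ((d ^ k) χ)) := by
  rw [binomialTensor_eq_pow, pow_succ', Module.End.mul_apply, ← binomialTensor_eq_pow,
    binomialTensor, map_sum]
  refine Finset.sum_congr rfl fun k _ => ?_
  rw [LinearMap.add_apply, LinearMap.rTensor_tmul, LinearMap.lTensor_tmul, map_smul, add_comm]

theorem exists_mem_inner_ne_zero {E : Type*} [NormedAddCommGroup E] [InnerProductSpace ℂ E]
    {X : Set E} (hX : Dense X) {x : E} (hx : x ≠ 0) : ∃ y ∈ X, inner ℂ y x ≠ 0 := by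
  by_contra! h
  have h1 := congrFun (Continuous.ext_on hX (f := fun y => inner ℂ y x) (g := fun _ => 0)
    (continuous_id.inner continuous_const) continuous_const h) x
  exact hx (inner_self_eq_zero.1 h1)

theorem mem_of_sum_smul_mem {E ι : Type*} [AddCommGroup E] [Module ℂ E] (K : Submodule ℂ E)
    {s : Finset ι} {i : ι} (hi : i ∈ s) {κ : ι → ℂ} {v : ι → E} (hκ : κ i ≠ 0)
    (hv : ∀ j ∈ s, j ≠ i → v j ∈ K) (h : ∑ j ∈ s, κ j • v j ∈ K) : v i ∈ K := by
  classical
  rw [← Finset.add_sum_erase s _ hi] at h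
  have h1 : ∑ j ∈ s.erase i, κ j • v j ∈ K := sum_mem fun j hj =>
    K.smul_mem _ (hv j (Finset.mem_of_mem_erase hj) (Finset.ne_of_mem_erase hj))
  have h2 := (K.add_mem_iff_left h1).1 h
  exact (K.smul_mem_iff hκ).1 h2

variable {A : H₁ →ₗ.[ℂ] H₁} {B : H₂ →ₗ.[ℂ] H₂} {a : H₁ →ₗ[ℂ] H₁} {d : H₂ →ₗ[ℂ] H₂}

/-- A product vector in the domain of a power of `A + B†` lies in the domains of the powers of
`A` and `B†`, and the power acts by the binomial theorem. -/
theorem prodVec_mem_graph_opPow (hA : Dense (A.domain : Set H₁)) (hA' : A.IsClosed)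
    (hB : Dense (B.domain : Set H₂)) (ha : ∀ (u : H₁) (h : u ∈ A.domain), A ⟨u, h⟩ = a u)
    (hd : ∀ (u : H₂) (h : u ∈ B†.domain), B† ⟨u, h⟩ = d u) {n : ℕ} {ξ : H₁} {χ : H₂}
    (hξ : ξ ≠ 0) (hχ : χ ≠ 0) {w : Composite H₁ H₂}
    (h : (prodVec ξ χ, w) ∈ (opPow (opSum A B†) n).graph) :
    ξ ∈ iterDomain a A.domain n ∧ χ ∈ iterDomain d B†.domain n ∧
      w = (binomialTensor a d n ξ χ : H₁ ⊗[ℂ] H₂) := by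
  have hAd := dense_adjoint_domain hA hA'
  induction n generalizing w with
  | zero =>
    refine ⟨trivial, trivial, ?_⟩
    rw [mem_graph_opPow_zero.1 h]
    simp [binomialTensor, prodVec]
  | succ n ih =>
    obtain ⟨v, h1, h2⟩ := mem_graph_opPow_succ.1 h
    obtain ⟨hξn, hχn, rfl⟩ := ih h1
    rw [graph_opSum (LinearPMap.adjoint_isFormalAdjoint hA)
      (LinearPMap.adjoint_isFormalAdjoint hB).symm hAd hB] at h2
    -- The graph is a closure, so at this stage `w` is known only weakly, tested against product
    -- vectors.
    have hpair : ∀ (x : A†.domain) (y : B.domain),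
        (∑ k ∈ Finset.range (n + 1), (n.choose k : ℂ) *
          (inner ℂ (A† x) ((a ^ (n - k)) ξ) * inner ℂ (y : H₂) ((d ^ k) χ) +
            inner ℂ (x : H₁) ((a ^ (n - k)) ξ) * inner ℂ (B y) ((d ^ k) χ))) =
          inner ℂ (prodVec (x : H₁) (y : H₂)) w := fun x y => by
      rw [← inner_sumGraph_prodVec (LinearPMap.adjoint_isFormalAdjoint hA)
        (LinearPMap.adjoint_isFormalAdjoint hB).symm h2 x y, inner_add_left, prodVec, prodVec,
        UniformSpace.Completion.inner_coe, UniformSpace.Completion.inner_coe, binomialTensor,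
        inner_sum, inner_sum, ← Finset.sum_add_distrib]
      refine Finset.sum_congr rfl fun k _ => ?_
      rw [TensorProduct.inner_tmul, TensorProduct.inner_tmul, inner_smul_right, inner_smul_right]
      ring
    -- Slicing with a fixed `y` not orthogonal to `χ` shows that a combination of the `a^(n-k) ξ`
    -- lies in `dom A††`, hence in `dom A`. All terms but `k = 0`, with coefficient `⟨y, χ⟩`, are
    -- already there.
    have hξ' : (a ^ n) ξ ∈ A.domain := by
      obtain ⟨y, hy, hy0⟩ := exists_mem_inner_ne_zero hB hχ
      refine mem_of_sum_smul_mem A.domain (s := Finset.range (n + 1)) (i := 0) (by simp)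
        (κ := fun k => (n.choose k : ℂ) * inner ℂ y ((d ^ k) χ)) (v := fun k => (a ^ (n - k)) ξ)
        (by simpa using hy0)
        (fun k _ hk => ?_) (adjoint_adjoint_domain_le hA hA' ?_)
      · exact pow_mem_of_mem_iterDomain (n := n) hξn (by
          have := Finset.mem_range.1 ‹_›
          omega)
      · refine LinearPMap.mem_adjoint_domain_of_exists _ ⟨(prodVecLeft H₂ y).adjoint w -
          ∑ k ∈ Finset.range (n + 1), ((n.choose k : ℂ) * inner ℂ (B ⟨y, hy⟩) ((d ^ k) χ)) •
            (a ^ (n - k)) ξ, fun x => ?_⟩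
        rw [← inner_conj_symm, ← inner_conj_symm (∑ k ∈ _, _)]
        congr 1
        rw [inner_sub_right, ContinuousLinearMap.adjoint_inner_right, prodVecLeft_apply,
          ← hpair x ⟨y, hy⟩, inner_sum, inner_sum, ← Finset.sum_sub_distrib]
        refine Finset.sum_congr rfl fun k _ => ?_
        rw [inner_smul_right, inner_smul_right]
        ring
    have hχ' : (d ^ n) χ ∈ B†.domain := by
      obtain ⟨x, hx, hx0⟩ := exists_mem_inner_ne_zero hAd hξ
      refine mem_of_sum_smul_mem B†.domain (s := Finset.range (n + 1)) (i := n) (by simp)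
        (κ := fun k => (n.choose k : ℂ) * inner ℂ x ((a ^ (n - k)) ξ)) (v := fun k => (d ^ k) χ)
        (by simpa using hx0)
        (fun k _ hk => ?_) ?_
      · exact pow_mem_of_mem_iterDomain (n := n) hχn (by
          have := Finset.mem_range.1 ‹_›
          omega)
      · refine LinearPMap.mem_adjoint_domain_of_exists _ ⟨(prodVecRight x).adjoint w -
          ∑ k ∈ Finset.range (n + 1), ((n.choose k : ℂ) * inner ℂ (A† ⟨x, hx⟩)
            ((a ^ (n - k)) ξ)) • (d ^ k) χ, fun y => ?_⟩
        rw [← inner_conj_symm, ← inner_conj_symm (∑ k ∈ _, _)]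
        congr 1
        rw [inner_sub_right, ContinuousLinearMap.adjoint_inner_right, prodVecRight_apply,
          ← hpair ⟨x, hx⟩ y, inner_sum, inner_sum, ← Finset.sum_sub_distrib]
        refine Finset.sum_congr rfl fun k _ => ?_
        rw [inner_smul_right, inner_smul_right]
        ring
    have hξ'' := mem_iterDomain_succ hξn hξ'
    have hχ'' := mem_iterDomain_succ hχn hχ'
    refine ⟨hξ'', hχ'', ?_⟩
    rw [← sub_eq_zero]
    refine eq_zero_of_inner_prodVec hAd hB fun x hx y hy => ?_
    rw [inner_sub_right, ← hpair ⟨x, hx⟩ ⟨y, hy⟩, prodVec, UniformSpace.Completion.inner_coe,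
      binomialTensor_succ, inner_sum, ← Finset.sum_sub_distrib]
    refine Finset.sum_eq_zero fun k hk => ?_
    have hk' := Finset.mem_range.1 hk
    have m1 : (a ^ (n - k)) ξ ∈ A.domain := pow_mem_of_mem_iterDomain hξ'' (by omega)
    have m2 : (d ^ k) χ ∈ B†.domain := pow_mem_of_mem_iterDomain hχ'' hk'
    have e1 := LinearPMap.adjoint_isFormalAdjoint hA ⟨x, hx⟩ ⟨_, m1⟩
    have e2 := (LinearPMap.adjoint_isFormalAdjoint hB).symm ⟨y, hy⟩ ⟨_, m2⟩
    rw [ha] at e1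
    rw [hd] at e2
    rw [e1, e2, inner_add_right, TensorProduct.inner_tmul, TensorProduct.inner_tmul,
      inner_smul_right, inner_smul_right]
    ring

end ProductVectors

/-! ### Hilbert-Schmidt sums and factorization through the square root -/

section Hilbert

variable {E : Type*} [NormedAddCommGroup E] [InnerProductSpace ℂ E]


theorem hasSum_norm_inner_sq {ι : Type*} (e : HilbertBasis ι ℂ E) (x : E) :
    HasSum (fun i => ‖inner ℂ (e i) x‖ ^ 2) (‖x‖ ^ 2) := by
  have h2 := Complex.hasSum_re (e.hasSum_inner_mul_inner x x)
  rw [show (inner ℂ x x).re = ‖x‖ ^ 2 from inner_self_eq_norm_sq (𝕜 := ℂ) x] at h2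
  convert h2 using 2 with i
  rw [← inner_conj_symm x, Complex.conj_mul', ← Complex.ofReal_pow, Complex.ofReal_re]

theorem tsum_ofReal_norm_inner_sq {ι : Type*} (e : HilbertBasis ι ℂ E) (x : E) :
    ∑' i, ENNReal.ofReal (‖inner ℂ (e i) x‖ ^ 2) = ENNReal.ofReal (‖x‖ ^ 2) := by
  have h := hasSum_norm_inner_sq e x
  rw [← h.tsum_eq, ENNReal.ofReal_tsum_of_nonneg (fun i => sq_nonneg _) h.summable]

theorem hasSum_re_inner_of_hasSum_smul {ι : Type*} {p : ι → ℝ} {T : ι → E →L[ℂ] E}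
    {ρ : E →L[ℂ] E} (h : HasSum (fun i => (p i : ℂ) • T i) ρ) (u : E) :
    HasSum (fun i => p i * (inner ℂ u (T i u)).re) (inner ℂ u (ρ u)).re := by
  have h1 := h.mapL (innerSL ℂ u ∘L ContinuousLinearMap.apply ℂ E u)
  have h2 := Complex.hasSum_re h1
  change HasSum _ (inner ℂ u (ρ u)).re at h2
  convert h2 using 2 with i
  change _ = (inner ℂ u (((p i : ℂ) • T i) u)).re
  rw [smul_apply, inner_smul_right, Complex.re_ofReal_mul]

variable [CompleteSpace E]

/-- `∑ₖ ‖R wₖ‖² ≤ ‖R‖²_HS` for a finite family with `∑ₖ |wₖ⟩⟨wₖ| ≤ 1`. -/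
theorem sum_norm_sq_le_of_hasSum {ι κ : Type*} (e : HilbertBasis ι ℂ E) {R : E →L[ℂ] E} {t : ℝ}
    (ht : HasSum (fun i => ‖R (e i)‖ ^ 2) t) {s : Finset κ} {w : κ → E}
    (hw : ∀ x, ∑ k ∈ s, ‖inner ℂ (w k) x‖ ^ 2 ≤ ‖x‖ ^ 2) :
    ∑ k ∈ s, ‖R (w k)‖ ^ 2 ≤ t := by
  have hadj : ∀ i x, ENNReal.ofReal (‖inner ℂ (e i) (R x)‖ ^ 2) =
      ENNReal.ofReal (‖inner ℂ x (R.adjoint (e i))‖ ^ 2) := fun i x => by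
    rw [ContinuousLinearMap.adjoint_inner_right, norm_inner_symm]
  -- Passing to the adjoint lets the hypothesis on `w` be applied to each vector `R† eᵢ`; in
  -- `ENNReal` the double sums may be exchanged freely.
  have ht' : ∑' i, ENNReal.ofReal (‖R.adjoint (e i)‖ ^ 2) = ENNReal.ofReal t := by
    rw [← ht.tsum_eq, ENNReal.ofReal_tsum_of_nonneg (fun i => sq_nonneg _) ht.summable]
    simp_rw [← tsum_ofReal_norm_inner_sq e (R.adjoint _), ← tsum_ofReal_norm_inner_sq e (R _),
      hadj]
    exact ENNReal.tsum_comm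
  have ht0 : 0 ≤ t := ht.nonneg fun i => sq_nonneg _
  rw [← ENNReal.ofReal_le_ofReal_iff ht0, ← ht', ENNReal.ofReal_sum_of_nonneg
    (fun k _ => sq_nonneg _)]
  simp_rw [← tsum_ofReal_norm_inner_sq e (R _), hadj]
  rw [← Summable.tsum_finsetSum (fun _ _ => ENNReal.summable)]
  refine ENNReal.tsum_le_tsum fun i => ?_
  rw [← ENNReal.ofReal_sum_of_nonneg (fun k _ => sq_nonneg _)]
  exact ENNReal.ofReal_le_ofReal (hw _)

/-- The functional `T x ↦ ⟨v, x⟩` is well defined and contractive on the range of `T`; extend it by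
Hahn-Banach, represent it by Riesz, and project onto the closed range. -/
theorem exists_inner_eq_of_norm_inner_le {T : E →L[ℂ] E} {v : E}
    (h : ∀ x, ‖inner ℂ v x‖ ≤ ‖T x‖) :
    ∃ w : E, w ∈ (LinearMap.range T.toLinearMap).topologicalClosure ∧
      ∀ x, inner ℂ w (T x) = inner ℂ v x := by
  obtain ⟨σ, hσ⟩ := LinearMap.exists_rightInverse_of_surjective T.toLinearMap.rangeRestrict
    (LinearMap.range_rangeRestrict _)
  have hσ' : ∀ y, T (σ y) = y := fun y => congrArg Subtype.val (LinearMap.congr_fun hσ y)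
  obtain ⟨g, hg, -⟩ := exists_extension_norm_eq _
    (((innerₛₗ ℂ v) ∘ₗ σ).mkContinuous 1 fun y => by
      rw [one_mul]
      refine (h (σ y)).trans_eq ?_
      rw [hσ']
      rfl)
  set K := (LinearMap.range T.toLinearMap).topologicalClosure
  have : CompleteSpace K := (Submodule.isClosed_topologicalClosure _).completeSpace_coe
  refine ⟨K.starProjection ((InnerProductSpace.toDual ℂ E).symm g),
    K.starProjection_apply_mem _, fun x => ?_⟩
  have hx : T x ∈ LinearMap.range T.toLinearMap := ⟨x, rfl⟩
  rw [K.inner_starProjection_left_eq_right, K.starProjection_eq_self_iff.2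
    (Submodule.le_topologicalClosure _ hx), InnerProductSpace.toDual_symm_apply]
  refine (hg ⟨T x, hx⟩).trans ?_
  change inner ℂ v (σ ⟨T x, hx⟩) = _
  rw [← sub_eq_zero, ← inner_sub_right, ← norm_le_zero_iff]
  refine (h _).trans_eq ?_
  rw [map_sub, hσ', sub_self, norm_zero]

/-- A finite family with `∑ₖ |vₖ⟩⟨vₖ| ≤ T²` is of the form `vₖ = T wₖ` with
`∑ₖ |wₖ⟩⟨wₖ| ≤ 1`. -/
theorem exists_preimages_of_sum_le {κ : Type*} {T : E →L[ℂ] E}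
    (hT : ∀ x y, inner ℂ (T x) y = inner ℂ x (T y)) {s : Finset κ} {v : κ → E}
    (h : ∀ x, ∑ k ∈ s, ‖inner ℂ (v k) x‖ ^ 2 ≤ ‖T x‖ ^ 2) :
    ∃ w : κ → E, (∀ k ∈ s, T (w k) = v k) ∧
      ∀ x, ∑ k ∈ s, ‖inner ℂ (w k) x‖ ^ 2 ≤ ‖x‖ ^ 2 := by
  have h1 : ∀ k ∈ s, ∃ w : E, w ∈ (LinearMap.range T.toLinearMap).topologicalClosure ∧
      ∀ x, inner ℂ w (T x) = inner ℂ (v k) x := fun k hk =>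
    exists_inner_eq_of_norm_inner_le fun x => le_of_sq_le_sq
      ((Finset.single_le_sum (f := fun k => ‖inner ℂ (v k) x‖ ^ 2)
        (fun _ _ => sq_nonneg _) hk).trans (h x)) (norm_nonneg _)
  choose! w hwK hw using h1
  set K := (LinearMap.range T.toLinearMap).topologicalClosure with hK
  have : CompleteSpace K := (Submodule.isClosed_topologicalClosure _).completeSpace_coe
  refine ⟨w, fun k hk => ext_inner_right ℂ fun x => by rw [hT, hw k hk], fun x => ?_⟩
  have hKle : ∀ y ∈ K, ∑ k ∈ s, ‖inner ℂ (w k) y‖ ^ 2 ≤ ‖y‖ ^ 2 := fun y hy => by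
    refine closure_minimal (s := Set.range T)
      (t := {y | ∑ k ∈ s, ‖inner ℂ (w k) y‖ ^ 2 ≤ ‖y‖ ^ 2}) ?_
      (isClosed_le (by fun_prop) (by fun_prop)) hy
    rintro _ ⟨x, rfl⟩
    change ∑ k ∈ s, ‖inner ℂ (w k) (T x)‖ ^ 2 ≤ ‖T x‖ ^ 2
    rw [Finset.sum_congr rfl fun k hk => by rw [hw k hk x]]
    exact h x
  have hproj : ∀ k ∈ s, inner ℂ (w k) x = inner ℂ (w k) (K.starProjection x) := fun k hk => by
    rw [← K.inner_starProjection_left_eq_right, K.starProjection_eq_self_iff.2 (hwK k hk)]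
  rw [Finset.sum_congr rfl fun k hk => by rw [hproj k hk]]
  refine (hKle _ (K.starProjection_apply_mem x)).trans ?_
  gcongr
  exact K.norm_starProjection_apply_le x

theorem sqrt_symmetric (ρ : E →L[ℂ] E) (x y : E) :
    inner ℂ (CFC.sqrt ρ x) y = inner ℂ x (CFC.sqrt ρ y) :=
  (ContinuousLinearMap.nonneg_iff_isPositive _).1 (CFC.sqrt_nonneg ρ) |>.isSymmetric x y

theorem sqrt_sqrt_apply {ρ : E →L[ℂ] E} (hρ : ρ.IsPositive) (x : E) :
    CFC.sqrt ρ (CFC.sqrt ρ x) = ρ x :=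
  DFunLike.congr_fun (CFC.sqrt_mul_sqrt_self ρ
    ((ContinuousLinearMap.nonneg_iff_isPositive _).2 hρ)) x

theorem norm_sqrt_apply_sq {ρ : E →L[ℂ] E} (hρ : ρ.IsPositive) (x : E) :
    ‖CFC.sqrt ρ x‖ ^ 2 = (inner ℂ x (ρ x)).re := by
  rw [← sqrt_sqrt_apply hρ, ← sqrt_symmetric]
  exact (inner_self_eq_norm_sq (𝕜 := ℂ) _).symm

theorem IsDensityOperator.hasSum_norm_sqrt_sq {ρ : E →L[ℂ] E} (hρ : IsDensityOperator ρ)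
    {s : Set E} (e : HilbertBasis s ℂ E) : HasSum (fun i => ‖CFC.sqrt ρ (e i)‖ ^ 2) 1 := by
  simp_rw [norm_sqrt_apply_sq hρ.1]
  simpa using Complex.hasSum_re (hρ.2 s e)

end Hilbert

/-! ### Expectation values as Hilbert-Schmidt norms -/

section Expectation

variable {E : Type*} [NormedAddCommGroup E] [InnerProductSpace ℂ E] [CompleteSpace E]

/-- For formally adjoint `Y` and `X`, the expectation value `⟨Y X⟩` is the square of the
Hilbert-Schmidt norm of `X √ρ`. -/
theorem HasExpectation.exists_hasSum {ρ : E →L[ℂ] E} (hρ : ρ.IsPositive)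
    {Y X : E →ₗ.[ℂ] E} {t : ℂ} (hadj : Y.IsFormalAdjoint X) (h : HasExpectation ρ Y X t) :
    t.im = 0 ∧ ∃ Q R : E →L[ℂ] E, (∀ x y, inner ℂ (Q x) y = inner ℂ x (Q y)) ∧
      (∀ x, ‖Q x‖ ^ 2 = (inner ℂ x (ρ x)).re) ∧ (∀ u, (Q u, R u) ∈ X.graph) ∧
      ∀ (s : Set E) (e : HilbertBasis s ℂ E), HasSum (fun i => ‖R (e i)‖ ^ 2) t.re := by
  obtain ⟨hY, L, R, hR, hL, htr⟩ := h
  -- That is, `L = R†`: formal adjointness gives it on `dom Y`, density everywhere.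
  have hLR : ∀ x u, inner ℂ (L x) u = inner ℂ x (R u) := fun x u => by
    refine congrFun (Continuous.ext_on hY (f := fun x => inner ℂ (L x) u)
      (g := fun x => inner ℂ x (R u)) (by fun_prop) (by fun_prop) fun y hy => ?_) x
    obtain ⟨hu, hRu⟩ := hR u
    change inner ℂ (L y) u = inner ℂ y (R u)
    rw [hL ⟨y, hy⟩, sqrt_symmetric, hRu]
    exact hadj ⟨y, hy⟩ ⟨_, hu⟩
  have hinner : ∀ x, inner ℂ x ((L ∘L R) x) = ((‖R x‖ ^ 2 : ℝ) : ℂ) := fun x => by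
    rw [← inner_conj_symm, ContinuousLinearMap.comp_apply, hLR, inner_self_eq_norm_sq_to_K]
    simp
  have hsum : ∀ (s : Set E) (e : HilbertBasis s ℂ E),
      HasSum (fun i => ((‖R (e i)‖ ^ 2 : ℝ) : ℂ)) t := fun s e => by
    simp_rw [← hinner]
    exact htr s e
  refine ⟨?_, CFC.sqrt ρ, R, sqrt_symmetric ρ, norm_sqrt_apply_sq hρ, fun u => ?_,
    fun s e => by
    simpa only [Complex.ofReal_re] using Complex.hasSum_re (hsum s e)⟩
  · obtain ⟨s, e, -⟩ := exists_hilbertBasis ℂ E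
    have h := Complex.hasSum_im (hsum s e)
    simp only [Complex.ofReal_im] at h
    exact h.unique hasSum_zero
  · obtain ⟨hu, hRu⟩ := hR u
    rw [hRu]
    exact X.mem_graph ⟨_, hu⟩

end Expectation

/-! ### Separable states -/

section Separable

variable {H₁ H₂ : Type*} [NormedAddCommGroup H₁] [InnerProductSpace ℂ H₁]
  [NormedAddCommGroup H₂] [InnerProductSpace ℂ H₂]

theorem opTensor_prodVec (r₁ : H₁ →L[ℂ] H₁) (r₂ : H₂ →L[ℂ] H₂) (x : H₁) (y : H₂) :
    opTensor r₁ r₂ (prodVec x y) = prodVec (r₁ x) (r₂ y) :=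
  ContinuousLinearMap.completion_apply_coe _ _

theorem opTensor_opTensor (r₁ r₁' : H₁ →L[ℂ] H₁) (r₂ r₂' : H₂ →L[ℂ] H₂)
    (x : Composite H₁ H₂) :
    opTensor r₁ r₂ (opTensor r₁' r₂' x) = opTensor (r₁ ∘L r₁') (r₂ ∘L r₂') x := by
  refine UniformSpace.Completion.induction_on x
    (isClosed_eq (by fun_prop) (by fun_prop)) fun t => ?_
  simp only [opTensor, ContinuousLinearMap.completion_apply_coe]
  rw [TensorProduct.mapL_comp]
  rfl

theorem inner_opTensor_prodVec {r₁ : H₁ →L[ℂ] H₁} {r₂ : H₂ →L[ℂ] H₂}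
    (h₁ : ∀ x y, inner ℂ (r₁ x) y = inner ℂ x (r₁ y))
    (h₂ : ∀ x y, inner ℂ (r₂ x) y = inner ℂ x (r₂ y)) (x : H₁) (y : H₂) (u : Composite H₁ H₂) :
    inner ℂ (prodVec (r₁ x) (r₂ y)) u = inner ℂ (prodVec x y) (opTensor r₁ r₂ u) := by
  refine UniformSpace.Completion.induction_on u
    (isClosed_eq (by fun_prop) (by fun_prop)) fun t => ?_
  induction t using TensorProduct.induction_on with
  | zero => rw [UniformSpace.Completion.coe_zero, map_zero, inner_zero_right, inner_zero_right]
  | tmul x' y' =>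
    change inner ℂ _ (prodVec x' y') = inner ℂ _ (opTensor r₁ r₂ (prodVec x' y'))
    rw [opTensor_prodVec, inner_prodVec, inner_prodVec, h₁, h₂]
  | add s t hs ht =>
    rw [UniformSpace.Completion.coe_add, map_add, inner_add_right, inner_add_right, hs, ht]

theorem inner_opTensor {r₁ : H₁ →L[ℂ] H₁} {r₂ : H₂ →L[ℂ] H₂}
    (h₁ : ∀ x y, inner ℂ (r₁ x) y = inner ℂ x (r₁ y))
    (h₂ : ∀ x y, inner ℂ (r₂ x) y = inner ℂ x (r₂ y)) (u v : Composite H₁ H₂) :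
    inner ℂ (opTensor r₁ r₂ u) v = inner ℂ u (opTensor r₁ r₂ v) := by
  refine UniformSpace.Completion.induction_on u
    (isClosed_eq (by fun_prop) (by fun_prop)) fun t => ?_
  induction t using TensorProduct.induction_on with
  | zero => rw [UniformSpace.Completion.coe_zero, map_zero, inner_zero_left, inner_zero_left]
  | tmul x y =>
    change inner ℂ (opTensor r₁ r₂ (prodVec x y)) v = inner ℂ (prodVec x y) _
    rw [opTensor_prodVec, inner_opTensor_prodVec h₁ h₂]
  | add s t hs ht =>
    rw [UniformSpace.Completion.coe_add, map_add, inner_add_left, inner_add_left, hs, ht]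

theorem orthonormal_prodVec {ι₁ ι₂ : Type*} {e₁ : ι₁ → H₁} {e₂ : ι₂ → H₂}
    (h₁ : Orthonormal ℂ e₁) (h₂ : Orthonormal ℂ e₂) :
    Orthonormal ℂ fun i : ι₁ × ι₂ => prodVec (e₁ i.1) (e₂ i.2) := by
  classical
  rw [orthonormal_iff_ite]
  rintro ⟨i₁, i₂⟩ ⟨j₁, j₂⟩
  simp [inner_prodVec, orthonormal_iff_ite.mp, h₁, h₂, ← ite_and, and_comm]

variable [CompleteSpace H₁] [CompleteSpace H₂]

theorem norm_opTensor_sqrt_sq {ρ₁ : H₁ →L[ℂ] H₁} {ρ₂ : H₂ →L[ℂ] H₂} (h₁ : ρ₁.IsPositive)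
    (h₂ : ρ₂.IsPositive) (u : Composite H₁ H₂) :
    ‖opTensor (CFC.sqrt ρ₁) (CFC.sqrt ρ₂) u‖ ^ 2 = (inner ℂ u (opTensor ρ₁ ρ₂ u)).re := by
  have e₁ : CFC.sqrt ρ₁ ∘L CFC.sqrt ρ₁ = ρ₁ := ContinuousLinearMap.ext (sqrt_sqrt_apply h₁)
  have e₂ : CFC.sqrt ρ₂ ∘L CFC.sqrt ρ₂ = ρ₂ := ContinuousLinearMap.ext (sqrt_sqrt_apply h₂)
  conv_rhs => rw [← e₁, ← e₂, ← opTensor_opTensor,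
    ← inner_opTensor (sqrt_symmetric ρ₁) (sqrt_symmetric ρ₂)]
  exact (inner_self_eq_norm_sq (𝕜 := ℂ) _).symm

/-- Bessel's inequality for `e₁ ⊗ e₂`, applied to `(√ρ₁ ⊗ √ρ₂) u`. -/
theorem sum_norm_inner_prodVec_sqrt_le {ι₁ ι₂ : Type*} {e₁ : ι₁ → H₁} {e₂ : ι₂ → H₂}
    (he₁ : Orthonormal ℂ e₁) (he₂ : Orthonormal ℂ e₂) {ρ₁ : H₁ →L[ℂ] H₁} {ρ₂ : H₂ →L[ℂ] H₂}
    (h₁ : ρ₁.IsPositive) (h₂ : ρ₂.IsPositive) (s : Finset (ι₁ × ι₂)) (u : Composite H₁ H₂) :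
    ∑ i ∈ s, ‖inner ℂ (prodVec (CFC.sqrt ρ₁ (e₁ i.1)) (CFC.sqrt ρ₂ (e₂ i.2))) u‖ ^ 2 ≤
      (inner ℂ u (opTensor ρ₁ ρ₂ u)).re := by
  rw [← norm_opTensor_sqrt_sq h₁ h₂]
  simp_rw [inner_opTensor_prodVec (sqrt_symmetric ρ₁) (sqrt_symmetric ρ₂)]
  exact (orthonormal_prodVec he₁ he₂).sum_inner_products_le _

end Separable

open Filter Topology in
theorem le_of_sum_mul_le {ι₁ ι₂ : Type*} {p : ℕ → ℝ} {q₁ : ℕ → ι₁ → ℝ} {q₂ : ℕ → ι₂ → ℝ}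
    (hp : HasSum p 1) (h₁ : ∀ m, HasSum (q₁ m) 1) (h₂ : ∀ m, HasSum (q₂ m) 1) {C t : ℝ}
    (h : ∀ (M : Finset ℕ) (I : Finset ι₁) (J : Finset ι₂),
      C * ∑ m ∈ M, p m * ((∑ i ∈ I, q₁ m i) * ∑ j ∈ J, q₂ m j) ≤ t) : C ≤ t := by
  have hJ : ∀ (M : Finset ℕ) (I : Finset ι₁),
      C * ∑ m ∈ M, p m * ((∑ i ∈ I, q₁ m i) * 1) ≤ t := fun M I =>
    le_of_tendsto' (((tendsto_finsetSum M fun m _ =>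
      ((h₂ m).const_mul _).const_mul _)).const_mul C) (h M I)
  have hI : ∀ M : Finset ℕ, C * ∑ m ∈ M, p m * (1 * 1) ≤ t := fun M =>
    le_of_tendsto' (((tendsto_finsetSum M fun m _ =>
      (Tendsto.mul_const _ (h₁ m)).const_mul _)).const_mul C) (hJ M)
  simp only [mul_one] at hI
  have := le_of_tendsto' (Tendsto.const_mul C hp) hI
  rwa [mul_one] at this

variable {H₁ H₂ : Type*} [NormedAddCommGroup H₁] [InnerProductSpace ℂ H₁] [CompleteSpace H₁]
  [NormedAddCommGroup H₂] [InnerProductSpace ℂ H₂] [CompleteSpace H₂]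

/-- A lower bound for product vectors extends to separable states. -/
theorem IsSeparable.le_of_forall_prodVec {ρ : Composite H₁ H₂ →L[ℂ] Composite H₁ H₂}
    (hρ : IsSeparable ρ) {Q R : Composite H₁ H₂ →L[ℂ] Composite H₁ H₂} {C t : ℝ}
    (hQ : ∀ u v, inner ℂ (Q u) v = inner ℂ u (Q v))
    (hQρ : ∀ u, ‖Q u‖ ^ 2 = (inner ℂ u (ρ u)).re)
    (ht : ∀ (s : Set (Composite H₁ H₂)) (e : HilbertBasis s ℂ (Composite H₁ H₂)),
      HasSum (fun i => ‖R (e i)‖ ^ 2) t)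
    (h : ∀ (w : Composite H₁ H₂) (x : H₁) (y : H₂), Q w = prodVec x y →
      C * ‖prodVec x y‖ ^ 2 ≤ ‖R w‖ ^ 2) : C ≤ t := by
  obtain ⟨-, p, ρ₁, ρ₂, hp0, hp, h₁, h₂, hsum⟩ := hρ
  obtain ⟨s₀, e₀, -⟩ := exists_hilbertBasis ℂ (Composite H₁ H₂)
  obtain ⟨s₁, e₁, -⟩ := exists_hilbertBasis ℂ H₁
  obtain ⟨s₂, e₂, -⟩ := exists_hilbertBasis ℂ H₂
  refine le_of_sum_mul_le hp (fun m => (h₁ m).hasSum_norm_sqrt_sq e₁)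
    (fun m => (h₂ m).hasSum_norm_sqrt_sq e₂) fun M I J => ?_
  -- The weight is absorbed into the first factor, so that `v k` remains a product vector.
  set x : ℕ → s₁ → H₁ := fun m i => ((√(p m) : ℝ) : ℂ) • CFC.sqrt (ρ₁ m) (e₁ i) with hx
  set y : ℕ → s₂ → H₂ := fun m j => CFC.sqrt (ρ₂ m) (e₂ j) with hy
  set v : ℕ × s₁ × s₂ → Composite H₁ H₂ := fun k => prodVec (x k.1 k.2.1) (y k.1 k.2.2) with hv
  have hv' : ∀ k, v k = ((√(p k.1) : ℝ) : ℂ) •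
      prodVec (CFC.sqrt (ρ₁ k.1) (e₁ k.2.1)) (CFC.sqrt (ρ₂ k.1) (e₂ k.2.2)) := fun k => by
    simp only [hv, hx, hy, ← prodVecLeft_apply, map_smul]
  have hle : ∀ u, ∑ k ∈ M ×ˢ I ×ˢ J, ‖inner ℂ (v k) u‖ ^ 2 ≤ ‖Q u‖ ^ 2 := fun u => by
    rw [hQρ, Finset.sum_product]
    have hpos : ∀ m, 0 ≤ p m * (inner ℂ u (opTensor (ρ₁ m) (ρ₂ m) u)).re := fun m => by
      rw [← norm_opTensor_sqrt_sq (h₁ m).1 (h₂ m).1]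
      exact mul_nonneg (hp0 m) (sq_nonneg _)
    refine le_trans (Finset.sum_le_sum fun m _ => ?_)
      (sum_le_hasSum M (fun m _ => hpos m) (hasSum_re_inner_of_hasSum_smul hsum u))
    refine le_of_eq_of_le ?_ (mul_le_mul_of_nonneg_left (sum_norm_inner_prodVec_sqrt_le
      e₁.orthonormal e₂.orthonormal (h₁ m).1 (h₂ m).1 (I ×ˢ J) u) (hp0 m))
    rw [Finset.mul_sum]
    refine Finset.sum_congr rfl fun k _ => ?_
    rw [hv', inner_smul_left, norm_mul, mul_pow, RCLike.norm_conj, Complex.norm_real,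
      Real.norm_eq_abs, sq_abs, Real.sq_sqrt (hp0 m)]
  obtain ⟨w, hw, hbessel⟩ := exists_preimages_of_sum_le hQ hle
  refine le_trans (le_of_eq_of_le ?_ (Finset.sum_le_sum fun k hk =>
    h (w k) (x k.1 k.2.1) (y k.1 k.2.2) (hw k hk))) (sum_norm_sq_le_of_hasSum e₀ (ht s₀ e₀) hbessel)
  rw [← Finset.mul_sum, Finset.sum_product]
  congr 1
  refine Finset.sum_congr rfl fun m _ => ?_
  rw [Finset.sum_mul_sum, Finset.mul_sum, Finset.sum_product]
  refine Finset.sum_congr rfl fun i _ => ?_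
  rw [Finset.mul_sum]
  refine Finset.sum_congr rfl fun j _ => ?_
  rw [norm_prodVec, norm_smul, Complex.norm_real, Real.norm_eq_abs, mul_pow, mul_pow, sq_abs,
    Real.sq_sqrt (hp0 m), mul_assoc]

end Separability

end

/-! ### The main theorem -/

theorem theorem1 {H₁ : Type*} {H₂ : Type*}
    [NormedAddCommGroup H₁] [InnerProductSpace ℂ H₁] [CompleteSpace H₁]
    [NormedAddCommGroup H₂] [InnerProductSpace ℂ H₂] [CompleteSpace H₂]
    (A : H₁ →ₗ.[ℂ] H₁) (hA : Dense (A.domain : Set H₁)) (hA' : A.IsClosed)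
    (B : H₂ →ₗ.[ℂ] H₂) (hB : Dense (B.domain : Set H₂)) (hB' : B.IsClosed)
    (c : ℝ) (hc : 0 < c) (hcomm : Separability.HasCommutator B B† (c : ℂ))
    (ρ : Separability.Composite H₁ H₂ →L[ℂ] Separability.Composite H₁ H₂)
    (hρ : Separability.IsSeparable ρ)
    (n : ℕ) (f : ℂ)
    (hf : Separability.HasExpectation ρ
      (Separability.opPow (Separability.opSum A† B) n)
      (Separability.opPow (Separability.opSum A B†) n) f) :
    f.im = 0 ∧ c ^ n * (n ! : ℝ) ≤ f.re := by
  obtain ⟨a, ha⟩ := Separability.exists_linearMap_extension A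
  obtain ⟨b, hb⟩ := Separability.exists_linearMap_extension B
  obtain ⟨d, hd⟩ := Separability.exists_linearMap_extension B†
  have hladder := hcomm.isLadder hB hB' hc.le hb hd
  have hadj : (Separability.opPow (Separability.opSum A† B) n).IsFormalAdjoint
      (Separability.opPow (Separability.opSum A B†) n) := fun u' u =>
    Separability.inner_opPow_graph (fun _ _ _ _ h h' => Separability.inner_opSum_graph
      (LinearPMap.adjoint_isFormalAdjoint hA) (LinearPMap.adjoint_isFormalAdjoint hB).symm hA
      (Separability.dense_adjoint_domain hB hB') (Separability.dense_adjoint_domain hA hA') hB h h')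
      (LinearPMap.mem_graph _ u) (LinearPMap.mem_graph _ u')
  obtain ⟨him, Q, R, hQ, hQρ, hR, hsum⟩ := hf.exists_hasSum hρ.1.1 hadj
  refine ⟨him, hρ.le_of_forall_prodVec hQ hQρ hsum fun w ξ χ hw => ?_⟩
  have hgraph := hR w
  rw [hw] at hgraph
  rw [Separability.norm_prodVec, mul_pow]
  -- If one factor is zero, the product vector carries no domain information about the other, but
  -- the bound is trivial.
  rcases eq_or_ne ξ 0 with rfl | hξ
  · simp
  rcases eq_or_ne χ 0 with rfl | hχ
  · simp
  obtain ⟨-, hχn, hRw⟩ := Separability.prodVec_mem_graph_opPow hA hA' hB ha hd hξ hχ hgraph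
  rw [hRw, UniformSpace.Completion.norm_coe]
  exact hladder.le_norm_binomialTensor_sq hc.le a ξ hχn
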